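/- Lemma (linear Bernoulli factory). Let $C>1$, $0<\varepsilon<1$ and let $i\ge 0$ be an integer (the case of main interest is $i=1$). Consider the following recursive algorithm, which has access to independent flips of a $p$-coin with unknown $p$ and to one independent $U\sim\mathrm{Unif}([0,1])$. Its current problem is to flip a coin with mean $(Cp)^i$, or one with mean $(Cp)^i\,\frac{(C-1)p}{1-p}$, or one with mean $0$. It starts with the problem $(Cp)^i$. - Problem $(Cp)^i$ with $i=0$: halt and return $1$. - Problem $(Cp)^i$ with $0<i<4.6/\varepsilon$: flip the $p$-coin. On heads pass to the problem $(Cp)^{i-1}$, on tails pass to the problem $(Cp)^{i-1}\frac{(C-1)p}{1-p}$. - Problem $(Cp)^i\frac{(C-1)p}{1-p}$: flip a coin with mean $(C-1)/C$. On heads pass to the problem $(Cp)^{i+1}$, on tails pass to the problem $(Cp)^{i+1}\frac{(C-1)p}{1-p}$. - Problem $(Cp)^i$ with $i>0$ and $i\ge 4.6/\varepsilon$: flip a coin with mean $\alpha=(1+\varepsilon/2)^{-i}$. On tails pass to the problem with mean $0$. On heads replace $C$ by $C(1+\varepsilon/2)$ and $\varepsilon$ by $\varepsilon/2$ and pass to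 the problem $(Cp)^i$ for the new $C$ and $\varepsilon$. - Problem with mean $0$: halt and return $0$. The coins with known mean $a$ are produced from the current uniform number $u$, which is $U$ at first: the result is heads if $u<a$, and then $u$ is replaced by $u/a$; otherwise it is tails, and $u$ is replaced by $(u-a)/(1-a)$. Let $\mathcal A(u,x_1,x_2,\dots)\in\{0,1\}$ be the value that the algorithm returns for the uniform number $u$ and the $p$-coin flips $x_1,x_2,\dots$, undefined if it does not halt. Then $\mathcal A$ is a Bernoulli factory for $f(p)=(Cp)^i$ on $[0,p^*]$, where $p^*=(1-\varepsilon)/C$ (that is, for all $p$ with $0 \le Cp\le 1-\varepsilon$). This means: $p^*\in(0,1]$ and $f$ maps $[0,p^*]$ to $[0,1]$; $\mathcal A$ does not depend on $p$ and is computable (by a machine with finitely many instructions and real registers, exact real arithmetic and comparisons, which reads the coin flips one after the other); and whenever $p\in[0,p^*]$, $X_1,X_2,\dots$ are iid $\mathrm{Bern}(p)$ and $U\sim\mathrm{Unif}([0,1])$ is independent of them, the infimum $T$ of the times $t$ such that $X_1,\dots,X_t$ (together with $U$) already determine the returned value is a stopping time for the filtration $\sigma(U,X_1,\dots,X_t)$,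 $\mathbb P(T<\infty)=1$, and $\mathcal A(U,X_1,X_2,\dots)\sim\mathrm{Bern}((Cp)^i)$. -/

import Mathlib

open MeasureTheory ProbabilityTheory

universe u

namespace CoinFactory

/-! ### Outputs of step-by-step computations -/

/-- If `r n` is what a computation displays after `n` steps (`none` as long as it has not halted),
this is its output: the first displayed value, and `none` if the computation never halts. -/
noncomputable def firstOutput (r : ℕ → Option Bool) : Option Bool :=
  open Classical in
  if h : ∃ n, (r n).isSome = true then r (Nat.find h) else none

/-! ### Computability: machines over the real numbers that can read coins

These are finite-dimensional Blum-Shub-Smale machines (finitely many labelled instructions,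
finitely many real registers, exact arithmetic and comparisons) with one more instruction,
which reads the next value of the coin sequence. -/

/-- Arithmetic expressions in `k` real registers. -/
inductive Expr (k : ℕ) : Type
  | reg (r : Fin k)
  | const (c : ℝ)
  | add (a b : Expr k)
  | sub (a b : Expr k)
  | mul (a b : Expr k)
  | div (a b : Expr k)

/-- The value of an expression (with the convention `x / 0 = 0`). -/
noncomputable def Expr.eval {k : ℕ} (v : Fin k → ℝ) : Expr k → ℝ
  | .reg r => v r
  | .const c => c
  | .add a b => a.eval v + b.eval v
  | .sub a b => a.eval v - b.eval v
  | .mul a b => a.eval v * b.eval v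
  | .div a b => a.eval v / b.eval v

/-- The instructions of a machine with `m` labels and `k` registers. -/
inductive Instr (m k : ℕ) : Type
  /-- put the value of `e` into register `r` -/
  | assign (r : Fin k) (e : Expr k) (next : Fin m)
  /-- go to `yes` if `a < b`, and to `no` otherwise -/
  | branch (a b : Expr k) (yes no : Fin m)
  /-- read the next value of the coin sequence -/
  | coin (heads tails : Fin m)
  /-- stop with output `b` -/
  | halt (b : Bool)

/-- A machine: a finite program, the label where it starts and the register that holds the input.
All other registers are initially `0`. -/
structure Machine where
  labels : ℕ
  registers : ℕ
  entry : Fin labels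
  input : Fin registers
  code : Fin labels → Instr labels registers

namespace Machine

/-- A configuration: current label, register contents, and the coins not read so far. -/
structure Config (M : Machine) where
  label : Fin M.labels
  reg : Fin M.registers → ℝ
  coins : ℕ → Bool

/-- One step of the machine. -/
noncomputable def step (M : Machine) (c : M.Config) : M.Config :=
  match M.code c.label with
  | .assign r e next => ⟨next, Function.update c.reg r (e.eval c.reg), c.coins⟩
  | .branch a b yes no =>
      open Classical in
      ⟨if a.eval c.reg < b.eval c.reg then yes else no, c.reg, c.coins⟩
  | .coin heads tails =>
      ⟨if c.coins 0 = true then heads else tails, c.reg, fun n => c.coins (n + 1)⟩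
  | .halt _ => c

/-- What a configuration displays: the output, if the machine has halted. -/
def display (M : Machine) (c : M.Config) : Option Bool :=
  match M.code c.label with
  | .halt b => some b
  | _ => none

/-- The partial function computed by a machine; `none` means that it does not halt. -/
noncomputable def output (M : Machine) (u : unitInterval) (x : ℕ → Bool) : Option Bool :=
  firstOutput fun n =>
    M.display (M.step^[n] ⟨M.entry, Function.update 0 M.input (u : ℝ), x⟩)

end Machine

/-! ### Bernoulli factories

A candidate is a partial function of a number `u ∈ [0, 1]` and a sequence of coin values
(`true` is `1`, heads; `false` is `0`, tails) with values in `{0, 1}`. The value `none` means that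
no output is ever returned. -/

/-- The partial function is computed by a machine. -/
def IsComputable (A : unitInterval → (ℕ → Bool) → Option Bool) : Prop :=
  ∃ M : Machine, ∀ u x, A u x = M.output u x

/-- The infimum (in `ℕ∞`, hence `⊤` if there is none) of the times `t` such that the first `t`
coin values already determine the output. -/
noncomputable def runningTime (A : unitInterval → (ℕ → Bool) → Option Bool)
    (u : unitInterval) (x : ℕ → Bool) : ℕ∞ :=
  sInf ((fun t : ℕ => (t : ℕ∞)) ''
    {t : ℕ | ∃ b : Bool, ∀ y : ℕ → Bool, (∀ s < t, y s = x s) → A u y = some b})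

/-- `U` is uniform on `[0, 1]`, `X 0, X 1, …` are Bernoulli variables with mean `p`, and all of
these are independent. -/
structure IsCoinSource {Ω : Type u} [MeasurableSpace Ω] (P : Measure Ω) (p : ℝ)
    (U : Ω → unitInterval) (X : ℕ → Ω → Bool) : Prop where
  measurable_uniform : Measurable U
  measurable_coin : ∀ n, Measurable (X n)
  law_uniform : P.map U = volume
  law_coin : ∀ n, P {ω | X n ω = true} = ENNReal.ofReal p
  indep_coins : iIndepFun X P
  indep_uniform : IndepFun U (fun ω n => X n ω) P

/-- The natural filtration: at time `t` one knows `U` and the first `t` coin values. -/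
def naturalFiltration {Ω : Type u} [m : MeasurableSpace Ω] {U : Ω → unitInterval}
    {X : ℕ → Ω → Bool} (hU : Measurable U) (hX : ∀ n, Measurable (X n)) : Filtration ℕ m where
  seq t := MeasurableSpace.comap U inferInstance ⊔
    ⨆ s : ℕ, ⨆ _ : s < t, MeasurableSpace.comap (X s) inferInstance
  mono' := by
    intro a b hab
    refine sup_le le_sup_left (le_trans ?_ le_sup_right)
    refine iSup_le fun s => iSup_le fun hs => ?_
    exact le_iSup_of_le s (le_iSup_of_le (lt_of_lt_of_le hs hab) le_rfl)
  le' _ := sup_le hU.comap_le (iSup_le fun s => iSup_le fun _ => (hX s).comap_le)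

/-- `A` is a Bernoulli factory for the function `f : [0, pmax] → [0, 1]`. -/
structure IsBernoulliFactory (pmax : ℝ) (f : ℝ → ℝ)
    (A : unitInterval → (ℕ → Bool) → Option Bool) : Prop where
  pmax_mem : pmax ∈ Set.Ioc (0 : ℝ) 1
  map_mem : ∀ p ∈ Set.Icc 0 pmax, f p ∈ Set.Icc (0 : ℝ) 1
  computable : IsComputable A
  /-- the running time is a stopping time -/
  isStoppingTime : ∀ {Ω : Type u} [MeasurableSpace Ω] (P : Measure Ω) [IsProbabilityMeasure P],
    ∀ p ∈ Set.Icc 0 pmax, ∀ (U : Ω → unitInterval) (X : ℕ → Ω → Bool),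
    ∀ h : IsCoinSource P p U X,
      IsStoppingTime (naturalFiltration h.measurable_uniform h.measurable_coin)
        (fun ω => runningTime A (U ω) (fun n => X n ω))
  /-- the running time is almost surely finite -/
  finite_time : ∀ {Ω : Type u} [MeasurableSpace Ω] (P : Measure Ω) [IsProbabilityMeasure P],
    ∀ p ∈ Set.Icc 0 pmax, ∀ (U : Ω → unitInterval) (X : ℕ → Ω → Bool),
    IsCoinSource P p U X →
      ∀ᵐ ω ∂P, runningTime A (U ω) (fun n => X n ω) < ⊤
  /-- the output is a Bernoulli variable with mean `f p` -/
  law_output : ∀ {Ω : Type u} [MeasurableSpace Ω] (P : Measure Ω) [IsProbabilityMeasure P],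
    ∀ p ∈ Set.Icc 0 pmax, ∀ (U : Ω → unitInterval) (X : ℕ → Ω → Bool),
    IsCoinSource P p U X →
      (∀ b : Bool, MeasurableSet {ω | A (U ω) (fun n => X n ω) = some b}) ∧
      P {ω | A (U ω) (fun n => X n ω) = some true} = ENNReal.ofReal (f p) ∧
      P {ω | A (U ω) (fun n => X n ω) = some false} = ENNReal.ofReal (1 - f p)

/-! ### Recursive coin-flipping algorithms -/

/-- What an algorithm does at one level of the recursion, `σ` being the type of the problems
that it can face. -/
inductive Move (σ : Type) : Type
  /-- return `b` -/
  | halt (b : Bool)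
  /-- flip the `p`-coin and pass to one of two problems -/
  | flip (heads tails : σ)
  /-- flip a coin with known probability `a` of heads and pass to one of two problems -/
  | aux (a : ℝ) (heads tails : σ)

/-- A running algorithm: the current problem, the current uniform number, and the values of the
`p`-coin not read so far. -/
structure Run (σ : Type) where
  problem : σ
  unif : ℝ
  coins : ℕ → Bool

/-- One level of the recursion. The `p`-coin is read off the sequence. A coin with known
probability `a` of heads is flipped with the uniform number `u`, heads meaning `u < a`; the
position of `u` inside `[0, a)`, respectively `[a, 1]`, rescaled to `[0, 1]`, is kept as the
uniform number for later use (given the result of the flip it is again uniform). -/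
noncomputable def Run.step {σ : Type} (move : σ → Move σ) (c : Run σ) : Run σ :=
  match move c.problem with
  | .halt _ => c
  | .flip heads tails =>
      ⟨if c.coins 0 = true then heads else tails, c.unif, fun n => c.coins (n + 1)⟩
  | .aux a heads tails =>
      open Classical in
      if c.unif < a then ⟨heads, c.unif / a, c.coins⟩
      else ⟨tails, (c.unif - a) / (1 - a), c.coins⟩

/-- The value returned, if the algorithm has halted. -/
def Run.display {σ : Type} (move : σ → Move σ) (c : Run σ) : Option Bool :=
  match move c.problem with
  | .halt b => some b
  | _ => none

/-- The partial function of the uniform number and the coin sequence that the algorithm with the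
given moves computes, when it is started with problem `s`. -/
noncomputable def runAlgorithm {σ : Type} (move : σ → Move σ) (s : σ)
    (u : unitInterval) (x : ℕ → Bool) : Option Bool :=
  firstOutput fun n => Run.display move ((Run.step move)^[n] ⟨s, (u : ℝ), x⟩)

/-! ### The recursive factory for `(C p) ^ i` -/

/-- The problems that the recursive factory faces, the mean of the wanted Bernoulli variable being
* `(C * p) ^ i` for `power C ε i`,
* `(C * p) ^ i * ((C - 1) * p / (1 - p))` for `mixed C ε i`,
* `0` for `zero`. -/
inductive Problem : Type
  | power (C ε : ℝ) (i : ℕ)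
  | mixed (C ε : ℝ) (i : ℕ)
  | zero

/-- The moves of the recursive factory. -/
noncomputable def linearMove : Problem → Move Problem
  | .power C ε i =>
      open Classical in
      if i = 0 then .halt true
      else if 4.6 / ε ≤ (i : ℝ) then
        -- third piece, with `α = 1 / (1 + ε / 2) ^ i`, and reset of `C` and `ε`
        .aux (1 / (1 + ε / 2) ^ i) (.power (C * (1 + ε / 2)) (ε / 2) i) .zero
      else
        -- first piece
        .flip (.power C ε (i - 1)) (.mixed C ε (i - 1))
  | .mixed C ε i =>
      -- second piece
      .aux ((C - 1) / C) (.power C ε (i + 1)) (.mixed C ε (i + 1))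
  | .zero => .halt false

/-- The recursive factory for `(C p) ^ i`, with the tolerance `ε`. -/
noncomputable def linearFactory (C ε : ℝ) (i : ℕ) :
    unitInterval → (ℕ → Bool) → Option Bool :=
  runAlgorithm linearMove (.power C ε i)

end CoinFactory

namespace CoinFactory

/-! ### Absorbing displays -/

/-! The law of the output is a martingale argument. Each problem has a target mean, and every move
preserves it: the mean of the current problem is the average of the means of its successors
(`mean_linearMove`). At a halting problem the mean is the returned value. Hence by any level the
probability of having returned 1 is at most the initial mean, and that of having returned 0 is at
most one minus it. If the run halts almost surely, both bounds are attained in the limit.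

Almost sure halting (`neverProb_linearMove`) follows from two nested contractions. Let `Q` bound the
probability of never halting over all valid problems. A reset is followed with probability at least
1/2 by the problem with mean 0, so a problem `power` that resets has probability at most `Q / 2`.
For fixed `C` and `ε`, every unsolved problem below the reset threshold reaches a reset with a
probability bounded below independently of the exponent: one tails of the `p`-coin if needed, then
enough tails and one heads of the coin with mean `(C - 1) / C`. So the bound `Q / 2` spreads to all
exponents. This lower bound depends on `C` and `ε`, but the resulting factor 1/2 does not, and
iterating over all parameters gives 0.

To transfer this to an arbitrary probability space, `measure_displaySet` identifies the recursively
defined `haltProb` with the probability under the product of the uniform law and the law of iid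
flips. Rescaling the uniform number after a known coin leaves it uniform, and the coins after the
first one are again iid.

Computability is a simulation by an explicit machine. The stopping time property rests on
compactness of the Cantor space, which turns "determined by the first `t` coins" into a countable
condition. -/

theorem firstOutput_eq_some_iff {r : ℕ → Option Bool}
    (hr : ∀ n b, r n = some b → ∀ m, n ≤ m → r m = some b) {b : Bool} :
    firstOutput r = some b ↔ ∃ n, r n = some b := by
  classical
  unfold firstOutput
  constructor
  · intro h
    split_ifs at h with h'
    · exact ⟨_, h⟩
  · rintro ⟨n, hn⟩
    have h' : ∃ n, (r n).isSome = true := ⟨n, by simp [hn]⟩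
    rw [dif_pos h']
    have hfind := Nat.find_spec h'
    obtain ⟨c, hc⟩ := Option.isSome_iff_exists.1 hfind
    have h1 := hr _ _ hc _ (le_max_left _ n)
    have h2 := hr _ _ hn _ (le_max_right (Nat.find h') n)
    convert hc.trans (h1.symm.trans h2)

theorem display_iterate_of_absorbing {α : Type*} {f : α → α} {d : α → Option Bool}
    (hf : ∀ a b, d a = some b → f a = a) (a : α) (n : ℕ) (b : Bool)
    (h : d (f^[n] a) = some b) (m : ℕ) (hm : n ≤ m) : d (f^[m] a) = some b := by
  obtain ⟨k, rfl⟩ := Nat.exists_eq_add_of_le' hm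
  rw [Function.iterate_add_apply, Function.iterate_fixed (hf _ _ h), h]

/-- If every step of `f` is simulated by at least one step of `g`, then `f` and `g` display the same
first output. -/
theorem firstOutput_eq_of_simulation {α β : Type*} {f : α → α} {g : β → β}
    {d : α → Option Bool} {e : β → Option Bool}
    (hf : ∀ a b, d a = some b → f a = a) (hg : ∀ a b, e a = some b → g a = a)
    (R : α → β → Prop)
    (halt : ∀ a a' b, R a a' → d a = some b → ∃ k, e (g^[k] a') = some b)
    (cont : ∀ a a', R a a' → d a = none → ∃ k, 1 ≤ k ∧ R (f a) (g^[k] a'))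
    (quiet : ∀ a a', R a a' → d a = none → e a' = none)
    {a : α} {a' : β} (h : ∃ k, R a (g^[k] a')) :
    firstOutput (fun n => d (f^[n] a)) = firstOutput (fun n => e (g^[n] a')) := by
  -- The bound `n ≤ k` serves the converse direction: if `f` never displays anything, a related and
  -- silent configuration of `g` at a time `k ≥ n` contradicts a display of `g` at time `n`.
  have sim : ∀ n, (∀ m < n, d (f^[m] a) = none) → ∃ k, n ≤ k ∧ R (f^[n] a) (g^[k] a') := by
    intro n
    induction n with
    | zero => intro _; obtain ⟨k, hk⟩ := h; exact ⟨k, Nat.zero_le _, hk⟩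
    | succ n ih =>
      intro hn
      obtain ⟨k, hk, hR⟩ := ih fun m hm => hn m (by omega)
      obtain ⟨l, hl, hR'⟩ := cont _ _ hR (hn n (by omega))
      refine ⟨l + k, by omega, ?_⟩
      rwa [Function.iterate_succ_apply', Function.iterate_add_apply]
  have halts : ∀ n b, d (f^[n] a) = some b → ∃ k, e (g^[k] a') = some b := by
    intro n b hb
    classical
    have hex : ∃ n, d (f^[n] a) ≠ none := ⟨n, by simp [hb]⟩
    obtain ⟨k, -, hR⟩ := sim (Nat.find hex) fun m hm => by simpa using Nat.find_min hex hm
    have hb' : d (f^[Nat.find hex] a) = some b := by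
      obtain ⟨c, hc⟩ := Option.ne_none_iff_exists'.1 (Nat.find_spec hex)
      have h1 := display_iterate_of_absorbing hf a _ c hc _ (le_max_left _ n)
      have h2 := display_iterate_of_absorbing hf a _ b hb _ (le_max_right (Nat.find hex) n)
      rw [hc, ← h1, h2]
    obtain ⟨l, hl⟩ := halt _ _ _ hR hb'
    exact ⟨l + k, by rwa [Function.iterate_add_apply]⟩
  ext b
  rw [firstOutput_eq_some_iff (display_iterate_of_absorbing hf a),
    firstOutput_eq_some_iff (display_iterate_of_absorbing hg a')]
  refine ⟨fun ⟨n, hn⟩ => halts n b hn, fun ⟨n, hn⟩ => ?_⟩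
  by_contra hcon
  by_cases hall : ∀ m, d (f^[m] a) = none
  · obtain ⟨k, hk, hR⟩ := sim n fun m _ => hall m
    have h1 := quiet _ _ hR (hall n)
    have h2 := display_iterate_of_absorbing hg a' n b hn k hk
    simp [h1] at h2
  · push Not at hall
    obtain ⟨m, hm⟩ := hall
    obtain ⟨c, hc⟩ := Option.ne_none_iff_exists'.1 hm
    obtain ⟨k, hk⟩ := halts m c hc
    have h1 := display_iterate_of_absorbing hg a' n b hn _ (le_max_left n k)
    have h2 := display_iterate_of_absorbing hg a' k c hk _ (le_max_right n k)
    rw [h1, Option.some.injEq] at h2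
    exact hcon ⟨m, h2 ▸ hc⟩

/-! ### Execution of machines step by step -/

theorem Machine.step_of_display {M : Machine} (c : M.Config) (b : Bool)
    (h : M.display c = some b) : M.step c = c := by
  unfold Machine.display at h
  unfold Machine.step
  split at h <;> simp_all

theorem Run.step_of_display {σ : Type} {move : σ → Move σ} (c : Run σ) (b : Bool)
    (h : Run.display move c = some b) : Run.step move c = c := by
  unfold Run.display at h
  unfold Run.step
  split at h <;> simp_all

theorem Machine.step_assign {M : Machine} {l : Fin M.labels} {r : Fin M.registers}
    {e : Expr M.registers} {next : Fin M.labels} (h : M.code l = .assign r e next)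
    {v v' : Fin M.registers → ℝ} (hv : Function.update v r (e.eval v) = v') (x : ℕ → Bool) :
    M.step ⟨l, v, x⟩ = ⟨next, v', x⟩ := by
  simp only [Machine.step, h, hv]

theorem Machine.step_branch_pos {M : Machine} {l : Fin M.labels} {a b : Expr M.registers}
    {yes no : Fin M.labels} (h : M.code l = .branch a b yes no) {v : Fin M.registers → ℝ}
    (x : ℕ → Bool) (hlt : a.eval v < b.eval v) : M.step ⟨l, v, x⟩ = ⟨yes, v, x⟩ := by
  simp only [Machine.step, h, hlt, if_true]

theorem Machine.step_branch_neg {M : Machine} {l : Fin M.labels} {a b : Expr M.registers}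
    {yes no : Fin M.labels} (h : M.code l = .branch a b yes no) {v : Fin M.registers → ℝ}
    (x : ℕ → Bool) (hlt : ¬ a.eval v < b.eval v) : M.step ⟨l, v, x⟩ = ⟨no, v, x⟩ := by
  simp only [Machine.step, h, hlt, if_false]

theorem Machine.step_coin {M : Machine} {l heads tails : Fin M.labels}
    (h : M.code l = .coin heads tails) (v : Fin M.registers → ℝ) (x : ℕ → Bool) :
    M.step ⟨l, v, x⟩ = ⟨if x 0 = true then heads else tails, v, fun n => x (n + 1)⟩ := by
  simp only [Machine.step, h]

theorem Machine.display_halt {M : Machine} {c : M.Config} {b : Bool}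
    (h : M.code c.label = .halt b) : M.display c = some b := by
  simp only [Machine.display, h]

/-- The machine passes from one configuration to another in at least one step. -/
def Machine.StepsTo (M : Machine) (c d : M.Config) : Prop :=
  ∃ k, 1 ≤ k ∧ M.step^[k] c = d

theorem Machine.StepsTo.single {M : Machine} {c d : M.Config} (h : M.step c = d) :
    M.StepsTo c d :=
  ⟨1, le_rfl, h⟩

theorem Machine.StepsTo.head {M : Machine} {c d e : M.Config} (h : M.step c = d)
    (h' : M.StepsTo d e) : M.StepsTo c e := by
  obtain ⟨k, -, hk⟩ := h'
  exact ⟨k + 1, by omega, by rw [Function.iterate_succ_apply, h, hk]⟩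

theorem Machine.StepsTo.trans {M : Machine} {c d e : M.Config} (h : M.StepsTo c d)
    (h' : M.StepsTo d e) : M.StepsTo c e := by
  obtain ⟨k, hk, rfl⟩ := h
  obtain ⟨l, -, rfl⟩ := h'
  exact ⟨l + k, by omega, by rw [Function.iterate_add_apply]⟩

/-! ### A machine for the recursive factory -/

/-- The program of the recursive factory. Registers: `0` the uniform number, `1` the constant `C`,
`2` the tolerance `ε`, `3` the exponent `i`, `4` a power of `1 + ε / 2`, `5` a loop counter. The
problems `power`, `mixed`, `zero` are faced at the labels `3`, `8`, `23`. -/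
noncomputable def linearCode (C ε : ℝ) (i : ℕ) : Fin 24 → Instr 24 6 :=
  ![.assign 1 (.const C) 1,
    .assign 2 (.const ε) 2,
    .assign 3 (.const i) 3,
    .branch (.const 0) (.reg 3) 4 22,
    .branch (.reg 3) (.div (.const 4.6) (.reg 2)) 5 13,
    .coin 6 7,
    .assign 3 (.sub (.reg 3) (.const 1)) 3,
    .assign 3 (.sub (.reg 3) (.const 1)) 8,
    .branch (.reg 0) (.div (.sub (.reg 1) (.const 1)) (.reg 1)) 9 11,
    .assign 0 (.div (.reg 0) (.div (.sub (.reg 1) (.const 1)) (.reg 1))) 10,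
    .assign 3 (.add (.reg 3) (.const 1)) 3,
    .assign 0 (.div (.sub (.reg 0) (.div (.sub (.reg 1) (.const 1)) (.reg 1)))
      (.sub (.const 1) (.div (.sub (.reg 1) (.const 1)) (.reg 1)))) 12,
    .assign 3 (.add (.reg 3) (.const 1)) 8,
    .assign 4 (.const 1) 14,
    .assign 5 (.reg 3) 15,
    .branch (.const 0) (.reg 5) 16 18,
    .assign 4 (.mul (.reg 4) (.add (.const 1) (.div (.reg 2) (.const 2)))) 17,
    .assign 5 (.sub (.reg 5) (.const 1)) 15,
    .branch (.reg 0) (.div (.const 1) (.reg 4)) 19 23,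
    .assign 0 (.div (.reg 0) (.div (.const 1) (.reg 4))) 20,
    .assign 1 (.mul (.reg 1) (.add (.const 1) (.div (.reg 2) (.const 2)))) 21,
    .assign 2 (.div (.reg 2) (.const 2)) 3,
    .halt true,
    .halt false]

/-- The machine of the recursive factory. -/
noncomputable abbrev linearMachine (C ε : ℝ) (i : ℕ) : Machine where
  labels := 24
  registers := 6
  entry := 0
  input := 0
  code := linearCode C ε i

/-- A run of the recursive factory is represented by a configuration of its machine. -/
def Represents {C₀ ε₀ : ℝ} {i₀ : ℕ} (c : Run Problem)
    (d : (linearMachine C₀ ε₀ i₀).Config) : Prop :=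
  match c.problem with
  | .power C ε i => ∃ y z, d = ⟨(3 : Fin 24), ![c.unif, C, ε, i, y, z], c.coins⟩
  | .mixed C ε i => ∃ y z, d = ⟨(8 : Fin 24), ![c.unif, C, ε, i, y, z], c.coins⟩
  | .zero => d.label = (23 : Fin 24)

theorem update_zero_vec6 (a b c d e f x : ℝ) :
    Function.update ![a, b, c, d, e, f] (0 : Fin 6) x = ![x, b, c, d, e, f] := by
  ext k; fin_cases k <;> rfl

theorem update_one_vec6 (a b c d e f x : ℝ) :
    Function.update ![a, b, c, d, e, f] (1 : Fin 6) x = ![a, x, c, d, e, f] := by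
  ext k; fin_cases k <;> rfl

theorem update_two_vec6 (a b c d e f x : ℝ) :
    Function.update ![a, b, c, d, e, f] (2 : Fin 6) x = ![a, b, x, d, e, f] := by
  ext k; fin_cases k <;> rfl

theorem update_three_vec6 (a b c d e f x : ℝ) :
    Function.update ![a, b, c, d, e, f] (3 : Fin 6) x = ![a, b, c, x, e, f] := by
  ext k; fin_cases k <;> rfl

theorem update_four_vec6 (a b c d e f x : ℝ) :
    Function.update ![a, b, c, d, e, f] (4 : Fin 6) x = ![a, b, c, d, x, f] := by
  ext k; fin_cases k <;> rfl

theorem update_five_vec6 (a b c d e f x : ℝ) :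
    Function.update ![a, b, c, d, e, f] (5 : Fin 6) x = ![a, b, c, d, e, x] := by
  ext k; fin_cases k <;> rfl

section

variable {C₀ ε₀ : ℝ} {i₀ : ℕ}

theorem linearMachine_start (u : ℝ) (x : ℕ → Bool) :
    (linearMachine C₀ ε₀ i₀).StepsTo ⟨(0 : Fin 24), Function.update (0 : Fin 6 → ℝ) 0 u, x⟩
      ⟨(3 : Fin 24), ![u, C₀, ε₀, i₀, 0, 0], x⟩ := by
  have h0 : Function.update (0 : Fin 6 → ℝ) 0 u = ![u, 0, 0, 0, 0, 0] := by
    ext k; fin_cases k <;> rfl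
  rw [h0]
  refine .head (Machine.step_assign rfl (update_one_vec6 ..) x) ?_
  refine .head (Machine.step_assign rfl (update_two_vec6 ..) x) ?_
  exact .single (Machine.step_assign rfl (update_three_vec6 ..) x)

/-- Expressions contain only the four field operations, so a power with variable exponent needs a
loop: register 5 counts down while register 4 accumulates the factors. The accumulator `y` is
general for the induction. -/
theorem linearMachine_loop (u C ε z : ℝ) (x : ℕ → Bool) (j : ℕ) (y : ℝ) :
    (linearMachine C₀ ε₀ i₀).StepsTo ⟨(15 : Fin 24), ![u, C, ε, z, y, j], x⟩
      ⟨(18 : Fin 24), ![u, C, ε, z, y * (1 + ε / 2) ^ j, 0], x⟩ := by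
  induction j generalizing y with
  | zero =>
    refine .single ((Machine.step_branch_neg rfl _ ?_).trans ?_)
    · simp [Expr.eval]
    · simp
  | succ j ih =>
    refine .head (Machine.step_branch_pos rfl x ?_) ?_
    · simp [Expr.eval]; positivity
    refine .head (d := ⟨(17 : Fin 24), ![u, C, ε, z, y * (1 + ε / 2), (j + 1 : ℕ)], x⟩)
      (Machine.step_assign rfl (update_four_vec6 ..) x) ?_
    refine .head (d := ⟨(15 : Fin 24), ![u, C, ε, z, y * (1 + ε / 2), (j + 1 : ℕ) - 1], x⟩)
      (Machine.step_assign rfl (update_five_vec6 ..) x) ?_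
    rw [Nat.cast_succ, add_sub_cancel_right, pow_succ', ← mul_assoc]
    exact ih (y * (1 + ε / 2))

theorem linearMachine_power_zero (u C ε y z : ℝ) (x : ℕ → Bool) :
    ∃ k, (linearMachine C₀ ε₀ i₀).display ((linearMachine C₀ ε₀ i₀).step^[k]
      ⟨(3 : Fin 24), ![u, C, ε, (0 : ℕ), y, z], x⟩) = some true := by
  refine ⟨1, ?_⟩
  rw [Function.iterate_one, Machine.step_branch_neg rfl x (by simp [Expr.eval])]
  exact Machine.display_halt rfl

theorem linearMachine_power_coin (u C ε y z : ℝ) (i : ℕ) (hi : i ≠ 0) (h : ¬ 4.6 / ε ≤ (i : ℝ))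
    (x : ℕ → Bool) :
    (linearMachine C₀ ε₀ i₀).StepsTo ⟨(3 : Fin 24), ![u, C, ε, i, y, z], x⟩
      ⟨if x 0 = true then (3 : Fin 24) else (8 : Fin 24), ![u, C, ε, (i - 1 : ℕ), y, z],
        fun n => x (n + 1)⟩ := by
  have hi' : (0 : ℝ) < i := by positivity
  rw [Nat.cast_pred (by positivity)]
  refine .head (Machine.step_branch_pos rfl x (by exact hi')) ?_
  refine .head (Machine.step_branch_pos rfl x (by exact not_le.1 h)) ?_
  refine .head (Machine.step_coin rfl _ x) ?_
  split_ifs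
  · exact .single (Machine.step_assign rfl (update_three_vec6 ..) _)
  · exact .single (Machine.step_assign rfl (update_three_vec6 ..) _)

theorem linearMachine_power_third (u C ε y z : ℝ) (i : ℕ) (hi : i ≠ 0) (h : 4.6 / ε ≤ (i : ℝ))
    (x : ℕ → Bool) :
    (linearMachine C₀ ε₀ i₀).StepsTo ⟨(3 : Fin 24), ![u, C, ε, i, y, z], x⟩
      ⟨(18 : Fin 24), ![u, C, ε, i, (1 + ε / 2) ^ i, 0], x⟩ := by
  have hi' : (0 : ℝ) < i := by positivity
  refine .head (Machine.step_branch_pos rfl x (by exact hi')) ?_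
  refine .head (Machine.step_branch_neg rfl x (by exact not_lt.2 h)) ?_
  refine .head (Machine.step_assign rfl (update_four_vec6 ..) x) ?_
  refine .head (Machine.step_assign rfl (update_five_vec6 ..) x) ?_
  have h := linearMachine_loop (C₀ := C₀) (ε₀ := ε₀) (i₀ := i₀) u C ε i x i 1
  rwa [one_mul] at h

theorem linearMachine_reset (u C ε y z : ℝ) (i : ℕ) (h : u < 1 / y) (x : ℕ → Bool) :
    (linearMachine C₀ ε₀ i₀).StepsTo ⟨(18 : Fin 24), ![u, C, ε, i, y, z], x⟩
      ⟨(3 : Fin 24), ![u / (1 / y), C * (1 + ε / 2), ε / 2, i, y, z], x⟩ := by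
  refine .head (Machine.step_branch_pos rfl x (by exact h)) ?_
  refine .head (Machine.step_assign rfl (update_zero_vec6 ..) x) ?_
  refine .head (Machine.step_assign rfl (update_one_vec6 ..) x) ?_
  exact .single (Machine.step_assign rfl (update_two_vec6 ..) x)

theorem linearMachine_mixed_heads (u C ε y z : ℝ) (i : ℕ) (h : u < (C - 1) / C) (x : ℕ → Bool) :
    (linearMachine C₀ ε₀ i₀).StepsTo ⟨(8 : Fin 24), ![u, C, ε, i, y, z], x⟩
      ⟨(3 : Fin 24), ![u / ((C - 1) / C), C, ε, (i + 1 : ℕ), y, z], x⟩ := by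
  rw [Nat.cast_succ]
  refine .head (Machine.step_branch_pos rfl x (by exact h)) ?_
  refine .head (Machine.step_assign rfl (update_zero_vec6 ..) x) ?_
  exact .single (Machine.step_assign rfl (update_three_vec6 ..) x)

theorem linearMachine_mixed_tails (u C ε y z : ℝ) (i : ℕ) (h : ¬ u < (C - 1) / C)
    (x : ℕ → Bool) :
    (linearMachine C₀ ε₀ i₀).StepsTo ⟨(8 : Fin 24), ![u, C, ε, i, y, z], x⟩
      ⟨(8 : Fin 24), ![(u - (C - 1) / C) / (1 - (C - 1) / C), C, ε, (i + 1 : ℕ), y, z], x⟩ := by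
  rw [Nat.cast_succ]
  refine .head (Machine.step_branch_neg rfl x (by exact h)) ?_
  refine .head (Machine.step_assign rfl (update_zero_vec6 ..) x) ?_
  exact .single (Machine.step_assign rfl (update_three_vec6 ..) x)

theorem linearMachine_continues (c : Run Problem) (d : (linearMachine C₀ ε₀ i₀).Config)
    (hR : Represents c d) (hc : Run.display linearMove c = none) :
    ∃ d', (linearMachine C₀ ε₀ i₀).StepsTo d d' ∧ Represents (Run.step linearMove c) d' := by
  obtain ⟨s, u, x⟩ := c
  cases s with
  | zero => simp [Run.display, linearMove] at hc
  | mixed C ε i =>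
    obtain ⟨y, z, rfl⟩ := hR
    by_cases h : u < (C - 1) / C
    · refine ⟨_, linearMachine_mixed_heads u C ε y z i h x, ?_⟩
      simp only [Run.step, linearMove, h, if_true]
      exact ⟨y, z, rfl⟩
    · refine ⟨_, linearMachine_mixed_tails u C ε y z i h x, ?_⟩
      simp only [Run.step, linearMove, h, if_false]
      exact ⟨y, z, rfl⟩
  | power C ε i =>
    obtain ⟨y, z, rfl⟩ := hR
    by_cases hi : i = 0
    · simp [Run.display, linearMove, hi] at hc
    by_cases h : 4.6 / ε ≤ (i : ℝ)
    · have h1 := linearMachine_power_third (C₀ := C₀) (ε₀ := ε₀) (i₀ := i₀) u C ε y z i hi h x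
      by_cases hu : u < 1 / (1 + ε / 2) ^ i
      · refine ⟨_, h1.trans (linearMachine_reset u C ε _ 0 i hu x), ?_⟩
        simp only [Run.step, linearMove, hi, h, hu, if_true, if_false]
        exact ⟨_, _, rfl⟩
      -- On tails the machine does not rescale its uniform number. This is harmless, since
      -- `Represents` constrains only the label at the problem `zero`.
      · refine ⟨_, h1.trans (.single (Machine.step_branch_neg rfl x (by exact hu))), ?_⟩
        simp only [Run.step, linearMove, hi, h, hu, if_true, if_false]
        rfl
    · refine ⟨_, linearMachine_power_coin u C ε y z i hi h x, ?_⟩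
      simp only [Run.step, linearMove, hi, h, if_false]
      split_ifs
      · exact ⟨y, z, rfl⟩
      · exact ⟨y, z, rfl⟩

theorem linearMachine_halts (c : Run Problem) (d : (linearMachine C₀ ε₀ i₀).Config) (b : Bool)
    (hR : Represents c d) (hc : Run.display linearMove c = some b) :
    ∃ k, (linearMachine C₀ ε₀ i₀).display ((linearMachine C₀ ε₀ i₀).step^[k] d) = some b := by
  obtain ⟨s, u, x⟩ := c
  cases s with
  | zero =>
    obtain rfl : false = b := by simpa [Run.display, linearMove] using hc
    refine ⟨0, Machine.display_halt ?_⟩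
    change linearCode C₀ ε₀ i₀ d.label = _
    rw [show d.label = (23 : Fin 24) from hR]
    rfl
  | mixed C ε i => simp [Run.display, linearMove] at hc
  | power C ε i =>
    obtain ⟨y, z, rfl⟩ := hR
    by_cases hi : i = 0
    · subst hi
      obtain rfl : true = b := by simpa [Run.display, linearMove] using hc
      exact linearMachine_power_zero ..
    · by_cases h : 4.6 / ε ≤ (i : ℝ) <;> simp [Run.display, linearMove, hi, h] at hc

theorem linearMachine_quiet (c : Run Problem) (d : (linearMachine C₀ ε₀ i₀).Config)
    (hR : Represents c d) (hc : Run.display linearMove c = none) :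
    (linearMachine C₀ ε₀ i₀).display d = none := by
  obtain ⟨s, u, x⟩ := c
  cases s with
  | zero => simp [Run.display, linearMove] at hc
  | mixed C ε i => obtain ⟨y, z, rfl⟩ := hR; rfl
  | power C ε i => obtain ⟨y, z, rfl⟩ := hR; rfl

theorem isComputable_linearFactory : IsComputable (linearFactory C₀ ε₀ i₀) := by
  refine ⟨linearMachine C₀ ε₀ i₀, fun u x => ?_⟩
  refine firstOutput_eq_of_simulation Run.step_of_display Machine.step_of_display Represents
    linearMachine_halts ?_ linearMachine_quiet ?_
  · intro c d hR hc
    obtain ⟨_, ⟨k, hk, rfl⟩, h⟩ := linearMachine_continues c d hR hc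
    exact ⟨k, hk, h⟩
  · obtain ⟨k, -, hk⟩ := linearMachine_start (C₀ := C₀) (ε₀ := ε₀) (i₀ := i₀) u x
    exact ⟨k, 0, 0, hk⟩

end

/-! ### Dependence on finitely many coins -/

section Locality

variable {σ : Type} (move : σ → Move σ)

/-- What a run that starts with problem `s`, uniform number `u` and coins `x` displays at level
`n`. -/
noncomputable def displayAt (n : ℕ) (s : σ) (u : ℝ) (x : ℕ → Bool) : Option Bool :=
  Run.display move ((Run.step move)^[n] ⟨s, u, x⟩)

theorem displayAt_mono {n m : ℕ} (hnm : n ≤ m) {s : σ} {u : ℝ} {x : ℕ → Bool} {b : Bool}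
    (h : displayAt move n s u x = some b) : displayAt move m s u x = some b :=
  display_iterate_of_absorbing Run.step_of_display _ n b h m hnm

theorem runAlgorithm_eq_some_iff {s : σ} {u : unitInterval} {x : ℕ → Bool} {b : Bool} :
    runAlgorithm move s u x = some b ↔ ∃ n, displayAt move n s u x = some b :=
  firstOutput_eq_some_iff fun _ _ h _ hm => displayAt_mono move hm h

/-- One level of the recursion reads at most one coin. -/
theorem displayAt_congr (n : ℕ) (s : σ) (u : ℝ) {x y : ℕ → Bool} (h : ∀ k < n, x k = y k) :
    displayAt move n s u x = displayAt move n s u y := by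
  induction n generalizing s u x y with
  | zero => rfl
  | succ n ih =>
    unfold displayAt at ih ⊢
    rw [Function.iterate_succ_apply, Function.iterate_succ_apply]
    simp only [Run.step]
    cases hs : move s with
    | halt b => exact ih s u fun k hk => h k (by omega)
    | flip t f =>
      simp only [h 0 (by omega)]
      exact ih _ u fun k hk => h (k + 1) (by omega)
    | aux a t f =>
      dsimp only
      split_ifs
      · exact ih _ _ fun k hk => h k (by omega)
      · exact ih _ _ fun k hk => h k (by omega)

/-- The event that a run displays `b` at level `n`. -/
def displaySet (n : ℕ) (b : Bool) (s : σ) : Set (ℝ × (ℕ → Bool)) :=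
  {z | displayAt move n s z.1 z.2 = some b}

theorem displaySet_succ_of_halt {n : ℕ} {b c : Bool} {s : σ} (h : move s = .halt c) :
    displaySet move (n + 1) b s = displaySet move n b s := by
  ext ⟨u, x⟩
  simp only [displaySet, displayAt, Set.mem_ofPred_eq, Function.iterate_succ_apply, Run.step, h]

theorem displaySet_of_halt {n : ℕ} {b c : Bool} {s : σ} (h : move s = .halt c) :
    displaySet move n b s = {_z | c = b} := by
  induction n with
  | zero =>
    ext ⟨u, x⟩
    simp [displaySet, displayAt, Run.display, h]
  | succ n ih => rw [displaySet_succ_of_halt move h, ih]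

theorem displaySet_zero_of_flip {b : Bool} {s t f : σ} (h : move s = .flip t f) :
    displaySet move 0 b s = ∅ := by
  ext ⟨u, x⟩
  simp [displaySet, displayAt, Run.display, h]

theorem displaySet_zero_of_aux {b : Bool} {s t f : σ} {a : ℝ} (h : move s = .aux a t f) :
    displaySet move 0 b s = ∅ := by
  ext ⟨u, x⟩
  simp [displaySet, displayAt, Run.display, h]

theorem displaySet_succ_of_flip {n : ℕ} {b : Bool} {s t f : σ} (h : move s = .flip t f) :
    displaySet move (n + 1) b s =
      {z | z.2 0 = true ∧ (z.1, fun k => z.2 (k + 1)) ∈ displaySet move n b t} ∪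
        {z | z.2 0 = false ∧ (z.1, fun k => z.2 (k + 1)) ∈ displaySet move n b f} := by
  ext ⟨u, x⟩
  simp only [displaySet, displayAt, Set.mem_ofPred_eq, Function.iterate_succ_apply, Run.step, h,
    Set.mem_union]
  by_cases hx : x 0 = true <;> simp [hx]

theorem displaySet_succ_of_aux {n : ℕ} {b : Bool} {s t f : σ} {a : ℝ} (h : move s = .aux a t f) :
    displaySet move (n + 1) b s =
      {z | z.1 < a ∧ (z.1 / a, z.2) ∈ displaySet move n b t} ∪
        {z | ¬ z.1 < a ∧ ((z.1 - a) / (1 - a), z.2) ∈ displaySet move n b f} := by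
  ext ⟨u, x⟩
  simp only [displaySet, displayAt, Set.mem_ofPred_eq, Function.iterate_succ_apply, Run.step, h,
    Set.mem_union]
  by_cases hu : u < a <;> simp [hu]

theorem measurable_shift : Measurable fun (x : ℕ → Bool) (k : ℕ) => x (k + 1) :=
  measurable_pi_lambda _ fun k => measurable_pi_apply (k + 1)

theorem measurableSet_displaySet (n : ℕ) (b : Bool) (s : σ) :
    MeasurableSet (displaySet move n b s) := by
  induction n generalizing s with
  | zero =>
    cases h : move s with
    | halt c => rw [displaySet_of_halt move h]; exact .const _
    | flip t f => rw [displaySet_zero_of_flip move h]; exact .empty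
    | aux a t f => rw [displaySet_zero_of_aux move h]; exact .empty
  | succ n ih =>
    cases h : move s with
    | halt c => rw [displaySet_of_halt move h]; exact .const _
    | flip t f =>
      rw [displaySet_succ_of_flip move h]
      have hshift : Measurable fun z : ℝ × (ℕ → Bool) => (z.1, fun k => z.2 (k + 1)) :=
        measurable_fst.prodMk (measurable_shift.comp measurable_snd)
      have h0 : Measurable fun z : ℝ × (ℕ → Bool) => z.2 0 :=
        (measurable_pi_apply 0).comp measurable_snd
      exact .union ((h0 (measurableSet_singleton true)).inter (hshift (ih t)))
        ((h0 (measurableSet_singleton false)).inter (hshift (ih f)))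
    | aux a t f =>
      rw [displaySet_succ_of_aux move h]
      have hlt : MeasurableSet {z : ℝ × (ℕ → Bool) | z.1 < a} :=
        measurableSet_lt measurable_fst measurable_const
      have h1 : Measurable fun z : ℝ × (ℕ → Bool) => (z.1 / a, z.2) :=
        (measurable_fst.div_const a).prodMk measurable_snd
      have h2 : Measurable fun z : ℝ × (ℕ → Bool) => ((z.1 - a) / (1 - a), z.2) :=
        ((measurable_fst.sub_const a).div_const (1 - a)).prodMk measurable_snd
      exact .union (hlt.inter (h1 (ih t))) (hlt.compl.inter (h2 (ih f)))

/-! ### The running time -/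

/-- The infimum is attained because `ℕ∞` is well ordered, and an output determined by fewer coins is
also determined by more. -/
theorem runningTime_le_iff {A : unitInterval → (ℕ → Bool) → Option Bool} {u : unitInterval}
    {x : ℕ → Bool} {n : ℕ} :
    runningTime A u x ≤ n ↔ ∃ b, ∀ y : ℕ → Bool, (∀ k < n, y k = x k) → A u y = some b := by
  constructor
  · intro h
    have hne : ((fun t : ℕ => (t : ℕ∞)) '' {t : ℕ | ∃ b : Bool, ∀ y : ℕ → Bool,
        (∀ s < t, y s = x s) → A u y = some b}).Nonempty := by
      by_contra hempty
      rw [Set.not_nonempty_iff_eq_empty] at hempty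
      rw [runningTime, hempty, sInf_empty] at h
      exact absurd h (by simp)
    obtain ⟨t, ⟨b, hb⟩, ht⟩ := csInf_mem hne
    refine ⟨b, fun y hy => hb y fun k hk => hy k ?_⟩
    have : (t : ℕ∞) ≤ n := ht.trans_le h
    exact hk.trans_le (by exact_mod_cast this)
  · exact fun h => sInf_le ⟨n, h, rfl⟩

theorem runningTime_lt_top_of_eq_some {s : σ} {u : unitInterval} {x : ℕ → Bool} {b : Bool}
    (h : runAlgorithm move s u x = some b) : runningTime (runAlgorithm move s) u x < ⊤ := by
  obtain ⟨n, hn⟩ := (runAlgorithm_eq_some_iff move).1 h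
  refine lt_of_le_of_lt (b := (n : ℕ∞)) (runningTime_le_iff.2 ⟨b, fun y hy => ?_⟩)
    (ENat.natCast_lt_top n)
  exact (runAlgorithm_eq_some_iff move).2 ⟨n, by rwa [displayAt_congr move n s u hy]⟩

theorem isOpen_setOf_displayAt (n : ℕ) (s : σ) (u : ℝ) (b : Bool) :
    IsOpen {x : ℕ → Bool | displayAt move n s u x = some b} := by
  rw [isOpen_iff_mem_nhds]
  intro x hx
  refine Filter.mem_of_superset ((PiNat.isOpen_cylinder (fun _ => Bool) x n).mem_nhds
    (PiNat.self_mem_cylinder x n)) fun y hy => ?_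
  exact (displayAt_congr move n s u hy).trans hx

/-- By compactness of the Cantor space, if the output is determined by the first `t` coin values,
then it is returned within a bounded number of levels. -/
theorem exists_displayAt_of_determined {s : σ} {u : unitInterval} {x : ℕ → Bool} {t : ℕ} {b : Bool}
    (h : ∀ y : ℕ → Bool, (∀ k < t, y k = x k) → runAlgorithm move s u y = some b) :
    ∃ n, ∀ y : ℕ → Bool, (∀ k < t, y k = x k) → displayAt move n s u y = some b := by
  have hclosed : IsClosed {y : ℕ → Bool | ∀ k < t, y k = x k} := by
    simp only [Set.ofPred_forall]
    exact isClosed_iInter fun k => isClosed_iInter fun _ =>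
      isClosed_eq (continuous_apply k) continuous_const
  obtain ⟨n, hn⟩ := hclosed.isCompact.elim_directed_cover
    (fun n => {y : ℕ → Bool | displayAt move n s u y = some b})
    (fun n => isOpen_setOf_displayAt move n s u b)
    (fun y hy => Set.mem_iUnion.2 ((runAlgorithm_eq_some_iff move).1 (h y hy)))
    (Monotone.directed_le fun n m hnm y hy => displayAt_mono move hnm hy)
  exact ⟨n, fun y hy => hn hy⟩

/-- The condition quantifies over uncountably many `y`. By `exists_displayAt_of_determined` a single
level `n` serves all of them, and level `n` sees only finitely many coins, so finite lists padded
with `false` suffice. This leaves countable unions and intersections. -/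
theorem measurableSet_determined (s : σ) (x : ℕ → Bool) (t : ℕ) (b : Bool) :
    MeasurableSet {u : unitInterval | ∀ y : ℕ → Bool, (∀ k < t, y k = x k) →
      runAlgorithm move s u y = some b} := by
  have heq : {u : unitInterval | ∀ y : ℕ → Bool, (∀ k < t, y k = x k) →
      runAlgorithm move s u y = some b} =
      ⋃ n, ⋂ l : List Bool, ⋂ _ : ∀ k < t, l.getD k false = x k,
        {u : unitInterval | displayAt move n s u (fun k => l.getD k false) = some b} := by
    ext u
    simp only [Set.mem_ofPred_eq, Set.mem_iUnion, Set.mem_iInter]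
    refine ⟨fun h => ?_, fun ⟨n, hn⟩ y hy => ?_⟩
    · obtain ⟨n, hn⟩ := exists_displayAt_of_determined move h
      exact ⟨n, fun l hl => hn _ hl⟩
    · refine (runAlgorithm_eq_some_iff move).2 ⟨n, ?_⟩
      -- The length `max n t` covers both the `t` prescribed coins and the `n` coins that can be
      -- read.
      have hl : ∀ k < max n t, ((List.range (max n t)).map y).getD k false = y k := by
        intro k hk
        simp [List.getD_eq_getElem?_getD, List.getElem?_range hk]
      rw [← hn ((List.range (max n t)).map y) fun k hk =>
        (hl k (lt_max_of_lt_right hk)).trans (hy k hk)]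
      exact displayAt_congr move n s u fun k hk => (hl k (lt_max_of_lt_left hk)).symm
  rw [heq]
  refine .iUnion fun n => .iInter fun l => .iInter fun _ => ?_
  have hm : Measurable fun u : unitInterval => ((u : ℝ), fun k => l.getD k false) :=
    measurable_subtype_coe.prodMk measurable_const
  exact hm (measurableSet_displaySet move n b s)

/-- Splitting according to the returned value and the first `n` coin values, given by a finite list,
leaves for each list a measurable condition on `U` alone. -/
theorem isStoppingTime_runningTime {Ω : Type u} [MeasurableSpace Ω] {U : Ω → unitInterval}
    {X : ℕ → Ω → Bool} (hU : Measurable U) (hX : ∀ n, Measurable (X n)) (s : σ) :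
    IsStoppingTime (naturalFiltration hU hX)
      (fun ω => runningTime (runAlgorithm move s) (U ω) (fun n => X n ω)) := by
  intro n
  have heq : {ω | runningTime (runAlgorithm move s) (U ω) (fun n => X n ω) ≤ (n : ℕ∞)} =
      ⋃ b : Bool, ⋃ l : List Bool, (⋂ k, ⋂ _ : k < n, X k ⁻¹' {l.getD k false}) ∩
        U ⁻¹' {u | ∀ y : ℕ → Bool, (∀ k < n, y k = l.getD k false) →
          runAlgorithm move s u y = some b} := by
    ext ω
    simp only [Set.mem_ofPred_eq, runningTime_le_iff, Set.mem_iUnion, Set.mem_inter_iff,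
      Set.mem_iInter, Set.mem_preimage, Set.mem_singleton_iff]
    refine exists_congr fun b => ⟨fun h => ?_, fun ⟨l, hl, h⟩ y hy => ?_⟩
    · have hl : ∀ k < n, ((List.range n).map fun k => X k ω).getD k false = X k ω := by
        intro k hk
        simp [List.getD_eq_getElem?_getD, List.getElem?_range hk]
      exact ⟨_, fun k hk => (hl k hk).symm, fun y hy => h y fun k hk => (hy k hk).trans (hl k hk)⟩
    · exact h y fun k hk => (hy k hk).trans (hl k hk)
  have hUn : Measurable[naturalFiltration hU hX n] U :=
    Measurable.mono (comap_measurable U) le_sup_left le_rfl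
  have hXn : ∀ k < n, Measurable[naturalFiltration hU hX n] (X k) := fun k hk =>
    Measurable.mono (comap_measurable (X k))
      (le_sup_of_le_right (le_iSup_of_le k (le_iSup_of_le hk le_rfl))) le_rfl
  change MeasurableSet[naturalFiltration hU hX n]
    {ω | runningTime (runAlgorithm move s) (U ω) (fun n => X n ω) ≤ (n : ℕ∞)}
  rw [heq]
  refine .iUnion fun b => .iUnion fun l => .inter ?_ ?_
  · exact .iInter fun k => .iInter fun hk => hXn k hk (measurableSet_singleton _)
  · exact hUn (measurableSet_determined move s _ n b)

end Locality

/-! ### The law of a coin source -/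

/-- The law of one flip of a coin with mean `p`. -/
noncomputable def coinLaw (p : ℝ) : Measure Bool :=
  ENNReal.ofReal p • Measure.dirac true + ENNReal.ofReal (1 - p) • Measure.dirac false

theorem coinLaw_true (p : ℝ) : coinLaw p {true} = ENNReal.ofReal p := by
  simp [coinLaw]

theorem coinLaw_false (p : ℝ) : coinLaw p {false} = ENNReal.ofReal (1 - p) := by
  simp [coinLaw]

theorem isProbabilityMeasure_coinLaw {p : ℝ} (h0 : 0 ≤ p) (h1 : p ≤ 1) :
    IsProbabilityMeasure (coinLaw p) := by
  constructor
  simp only [coinLaw, Measure.coe_add, Measure.coe_smul, Pi.add_apply, Pi.smul_apply,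
    measure_univ, smul_eq_mul, mul_one]
  rw [← ENNReal.ofReal_add h0 (by linarith)]
  simp

theorem eq_coinLaw {p : ℝ} (h0 : 0 ≤ p) (μ : Measure Bool) [IsProbabilityMeasure μ]
    (h : μ {true} = ENNReal.ofReal p) : μ = coinLaw p := by
  refine Measure.ext_of_singleton fun b => ?_
  cases b with
  | true => rw [h, coinLaw_true]
  | false =>
    have hc : ({false} : Set Bool) = {true}ᶜ := by ext b; cases b <;> simp
    rw [coinLaw_false, hc, prob_compl_eq_one_sub (measurableSet_singleton _), h,
      ENNReal.ofReal_sub _ h0, ENNReal.ofReal_one]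

/-- The law of a sequence of independent flips of a coin with mean `p`. -/
noncomputable abbrev coinSeqLaw (p : ℝ) : Measure (ℕ → Bool) :=
  Measure.infinitePi fun _ => coinLaw p

/-- Prepending an independent value to an independent identically distributed sequence does not
change its law. -/
theorem map_cons_infinitePi {α : Type*} [MeasurableSpace α] (β : Measure α)
    [IsProbabilityMeasure β] :
    (β.prod (Measure.infinitePi fun _ : ℕ => β)).map
      (fun z (k : ℕ) => Nat.casesOn (motive := fun _ => α) k z.1 z.2) =
      Measure.infinitePi fun _ : ℕ => β := by
  classical
  have hm : Measurable fun (z : α × (ℕ → α)) (k : ℕ) =>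
      Nat.casesOn (motive := fun _ => α) k z.1 z.2 := by
    refine measurable_pi_lambda _ fun k => ?_
    cases k with
    | zero => exact measurable_fst
    | succ k => exact (measurable_pi_apply k).comp measurable_snd
  refine Measure.eq_infinitePi _ fun s t ht => ?_
  obtain ⟨N, hN⟩ := s.exists_nat_subset_range
  -- The finite index set is enlarged to an initial segment, with trivial factors at the new
  -- indices. Then coordinate 0 splits off and the others are shifted by one.
  set t' : ℕ → Set α := fun i => if i ∈ s then t i else Set.univ with ht'
  have hmt' : ∀ i, MeasurableSet (t' i) := by
    intro i
    simp only [ht']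
    split_ifs
    exacts [ht i, .univ]
  have hpi : Set.pi (s : Set ℕ) t = Set.pi (Finset.range (N + 1) : Set ℕ) t' := by
    ext x
    simp only [Set.mem_pi, ht', Finset.mem_coe]
    refine ⟨fun h i _ => ?_, fun h i hi => ?_⟩
    · split_ifs with his
      exacts [h i his, Set.mem_univ _]
    · have := h i (Finset.range_subset_range.2 (Nat.le_succ N) (hN hi))
      rwa [if_pos hi] at this
  have hprod : ∏ i ∈ s, β (t i) = ∏ i ∈ Finset.range (N + 1), β (t' i) := by
    rw [← Finset.prod_subset (hN.trans (Finset.range_subset_range.2 (Nat.le_succ N)))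
      (f := fun i => β (t' i))]
    · exact Finset.prod_congr rfl fun i hi => by simp [ht', hi]
    · intro i _ hi
      simp [ht', hi]
  have hpre : (fun (z : α × (ℕ → α)) (k : ℕ) =>
      Nat.casesOn (motive := fun _ => α) k z.1 z.2) ⁻¹' Set.pi (Finset.range (N + 1) : Set ℕ) t' =
      t' 0 ×ˢ Set.pi (Finset.range N : Set ℕ) fun i => t' (i + 1) := by
    ext ⟨a, x⟩
    simp only [Set.mem_preimage, Set.mem_pi, Finset.mem_coe, Finset.mem_range, Set.mem_prod]
    refine ⟨fun h => ⟨h 0 (by omega), fun i hi => h (i + 1) (by omega)⟩, fun h i hi => ?_⟩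
    cases i with
    | zero => exact h.1
    | succ i => exact h.2 i (by omega)
  rw [hpi, hprod, Measure.map_apply hm (.pi (Finset.countable_toSet _) fun i _ => hmt' i), hpre,
    Measure.prod_prod, Measure.infinitePi_pi _ fun i _ => hmt' (i + 1), Finset.prod_range_succ',
    mul_comm]

theorem coinSeqLaw_first_inter {p : ℝ} [IsProbabilityMeasure (coinLaw p)] (b : Bool)
    {S : Set (ℕ → Bool)} (hS : MeasurableSet S) :
    coinSeqLaw p {x | x 0 = b ∧ (fun k => x (k + 1)) ∈ S} = coinLaw p {b} * coinSeqLaw p S := by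
  have hm : Measurable fun (z : Bool × (ℕ → Bool)) (k : ℕ) =>
      Nat.casesOn (motive := fun _ => Bool) k z.1 z.2 := by
    refine measurable_pi_lambda _ fun k => ?_
    cases k with
    | zero => exact measurable_fst
    | succ k => exact (measurable_pi_apply k).comp measurable_snd
  have hmS : MeasurableSet {x : ℕ → Bool | x 0 = b ∧ (fun k => x (k + 1)) ∈ S} :=
    .inter (measurableSet_eq_fun (measurable_pi_apply 0) measurable_const) (measurable_shift hS)
  conv_lhs => rw [coinSeqLaw, ← map_cons_infinitePi, Measure.map_apply hm hmS]
  rw [← Measure.prod_prod]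
  rfl

/-- The law of a uniform number. -/
noncomputable abbrev uniformLaw : Measure ℝ :=
  volume.restrict (Set.Icc 0 1)

instance isProbabilityMeasure_uniformLaw : IsProbabilityMeasure uniformLaw :=
  ⟨by simp⟩

/-- Together with `uniformLaw_ge_inter` this is why one uniform number is enough for all known
coins: given the result of a flip, the rescaled number is again uniform. -/
theorem uniformLaw_lt_inter {a : ℝ} (h0 : 0 < a) (h1 : a < 1) {S : Set ℝ} (hS : MeasurableSet S) :
    uniformLaw {u | u < a ∧ u / a ∈ S} = ENNReal.ofReal a * uniformLaw S := by
  have hm : MeasurableSet {u : ℝ | u < a ∧ u / a ∈ S} :=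
    measurableSet_Iio.inter (measurable_id.div_const a hS)
  -- Rescaling `u < a` produces values in `[0, 1)`, so the right-hand side is moved to the half-open
  -- interval, which differs by a null set.
  rw [uniformLaw, Measure.restrict_apply hm, restrict_Ico_eq_restrict_Icc.symm,
    Measure.restrict_apply hS]
  have hset : {u : ℝ | u < a ∧ u / a ∈ S} ∩ Set.Icc 0 1 =
      (· * a⁻¹) ⁻¹' (S ∩ Set.Ico 0 1) := by
    ext u
    simp only [Set.mem_inter_iff, Set.mem_ofPred_eq, Set.mem_Icc, Set.mem_preimage, Set.mem_Ico,
      ← div_eq_mul_inv, le_div_iff₀ h0, div_lt_one h0, zero_mul]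
    constructor
    · rintro ⟨⟨h, h'⟩, h2, h3⟩; exact ⟨h', h2, h⟩
    · rintro ⟨h, h', h2⟩; exact ⟨⟨h2, h⟩, h', by linarith⟩
  rw [hset, Real.volume_preimage_mul_right (inv_ne_zero h0.ne'), inv_inv, abs_of_pos h0]

theorem uniformLaw_ge_inter {a : ℝ} (h0 : 0 < a) (h1 : a < 1) {S : Set ℝ} (hS : MeasurableSet S) :
    uniformLaw {u | ¬ u < a ∧ (u - a) / (1 - a) ∈ S} = ENNReal.ofReal (1 - a) * uniformLaw S := by
  have h1a : 0 < 1 - a := by linarith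
  have hm : MeasurableSet {u : ℝ | ¬ u < a ∧ (u - a) / (1 - a) ∈ S} :=
    measurableSet_Iio.compl.inter ((measurable_id.sub_const a).div_const (1 - a) hS)
  rw [uniformLaw, Measure.restrict_apply hm, Measure.restrict_apply hS]
  have hset : {u : ℝ | ¬ u < a ∧ (u - a) / (1 - a) ∈ S} ∩ Set.Icc 0 1 =
      (· - a) ⁻¹' ((· * (1 - a)⁻¹) ⁻¹' (S ∩ Set.Icc 0 1)) := by
    ext u
    simp only [Set.mem_inter_iff, Set.mem_ofPred_eq, Set.mem_Icc, Set.mem_preimage,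
      ← div_eq_mul_inv, le_div_iff₀ h1a, div_le_one h1a, zero_mul]
    constructor
    · rintro ⟨⟨h, h'⟩, h2, h3⟩; exact ⟨h', by linarith, by linarith⟩
    · rintro ⟨h, h', h2⟩; exact ⟨⟨by linarith, h⟩, by linarith, by linarith⟩
  rw [hset, (measurePreserving_sub_right volume a).measure_preimage ?_,
    Real.volume_preimage_mul_right (inv_ne_zero h1a.ne'), inv_inv, abs_of_pos h1a]
  exact ((measurable_id.mul_const _) (hS.inter measurableSet_Icc)).nullMeasurableSet

/-- This replaces an arbitrary probability space by one concrete product law, on which all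
probabilities are computed. -/
theorem IsCoinSource.map_eq {Ω : Type u} [MeasurableSpace Ω] {P : Measure Ω}
    [IsProbabilityMeasure P] {p : ℝ} (h0 : 0 ≤ p) [IsProbabilityMeasure (coinLaw p)]
    {U : Ω → unitInterval} {X : ℕ → Ω → Bool} (h : IsCoinSource P p U X) :
    P.map (fun ω => ((U ω : ℝ), fun n => X n ω)) = uniformLaw.prod (coinSeqLaw p) := by
  have hX : P.map (fun ω n => X n ω) = coinSeqLaw p := by
    have hXn : ∀ n, P.map (X n) = coinLaw p := fun n => by
      have := Measure.isProbabilityMeasure_map (μ := P) (h.measurable_coin n).aemeasurable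
      refine eq_coinLaw h0 _ ?_
      rw [Measure.map_apply (h.measurable_coin n) (measurableSet_singleton _)]
      exact h.law_coin n
    rw [h.indep_coins.map_fun_eq_infinitePi_map h.measurable_coin]
    simp_rw [hXn]
  have hU : P.map (fun ω => (U ω : ℝ)) = uniformLaw := by
    rw [uniformLaw, ← unitInterval, ← unitInterval.measurePreserving_coe.map_eq, ← h.law_uniform,
      Measure.map_map measurable_subtype_coe h.measurable_uniform]
    rfl
  have hmX : Measurable fun ω n => X n ω := measurable_pi_lambda _ h.measurable_coin
  have hind : IndepFun (fun ω => (U ω : ℝ)) (fun ω n => X n ω) P :=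
    h.indep_uniform.comp measurable_subtype_coe measurable_id
  have hmU : Measurable fun ω => (U ω : ℝ) := measurable_subtype_coe.comp h.measurable_uniform
  rw [(indepFun_iff_map_prod_eq_prod_map_map hmU.aemeasurable hmX.aemeasurable).1 hind, hU, hX]

/-! ### Probabilities of the outputs -/

section HaltProb

variable {σ : Type} (move : σ → Move σ) (p : ℝ)

/-- The probability that a run with mean `p` which starts with problem `s` has returned `b` at level
`n`. -/
noncomputable def haltProb : ℕ → Bool → σ → ℝ
  | 0, b, s =>
    match move s with
    | .halt c => if c = b then 1 else 0
    | _ => 0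
  | n + 1, b, s =>
    match move s with
    | .halt c => if c = b then 1 else 0
    | .flip t f => p * haltProb n b t + (1 - p) * haltProb n b f
    | .aux a t f => a * haltProb n b t + (1 - a) * haltProb n b f

/-- A set of problems that a run never leaves, and in which the known means lie strictly between `0`
and `1`. -/
structure IsInvariant (I : Set σ) : Prop where
  flip : ∀ {s t f}, s ∈ I → move s = .flip t f → t ∈ I ∧ f ∈ I
  aux : ∀ {s a t f}, s ∈ I → move s = .aux a t f → (0 < a ∧ a < 1) ∧ t ∈ I ∧ f ∈ I

variable {move} {p}

theorem haltProb_nonneg {I : Set σ} (hI : IsInvariant move I) (h0 : 0 ≤ p) (h1 : p ≤ 1)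
    (n : ℕ) (b : Bool) {s : σ} (hs : s ∈ I) : 0 ≤ haltProb move p n b s := by
  induction n generalizing s with
  | zero =>
    cases h : move s with
    | halt c => simp only [haltProb, h]; split_ifs <;> simp
    | flip t f => simp [haltProb, h]
    | aux a t f => simp [haltProb, h]
  | succ n ih =>
    cases h : move s with
    | halt c => simp only [haltProb, h]; split_ifs <;> simp
    | flip t f =>
      obtain ⟨ht, hf⟩ := hI.flip hs h
      simp only [haltProb, h]
      exact add_nonneg (mul_nonneg h0 (ih ht)) (mul_nonneg (by linarith) (ih hf))
    | aux a t f =>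
      obtain ⟨⟨ha0, ha1⟩, ht, hf⟩ := hI.aux hs h
      simp only [haltProb, h]
      exact add_nonneg (mul_nonneg ha0.le (ih ht)) (mul_nonneg (by linarith) (ih hf))

/-- By induction on the level. A `p`-coin is handled in slices with `u` fixed, a known coin in
slices with the coin sequence fixed, so Fubini is used in both orders. The invariant set supplies `0
< a < 1`, which the rescaling needs. -/
theorem measure_displaySet {I : Set σ} (hI : IsInvariant move I) (h0 : 0 ≤ p) (h1 : p ≤ 1)
    [IsProbabilityMeasure (coinLaw p)] (n : ℕ) (b : Bool) {s : σ} (hs : s ∈ I) :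
    uniformLaw.prod (coinSeqLaw p) (displaySet move n b s) =
      ENNReal.ofReal (haltProb move p n b s) := by
  have halt : ∀ c : Bool, uniformLaw.prod (coinSeqLaw p) {_z | c = b} =
      ENNReal.ofReal (if c = b then 1 else 0) := by
    intro c
    by_cases hcb : c = b <;> simp [hcb]
  induction n generalizing s with
  | zero =>
    cases h : move s with
    | halt c => rw [displaySet_of_halt move h, halt]; simp only [haltProb, h]
    | flip t f => rw [displaySet_zero_of_flip move h]; simp [haltProb, h]
    | aux a t f => rw [displaySet_zero_of_aux move h]; simp [haltProb, h]
  | succ n ih =>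
    have hms := measurableSet_displaySet move (n + 1) b s
    cases h : move s with
    | halt c => rw [displaySet_of_halt move h, halt]; simp only [haltProb, h]
    | flip t f =>
      obtain ⟨ht, hf⟩ := hI.flip hs h
      have hmt := measurableSet_displaySet move n b t
      have hmf := measurableSet_displaySet move n b f
      have hsec : ∀ u : ℝ, coinSeqLaw p (Prod.mk u ⁻¹' displaySet move (n + 1) b s) =
          ENNReal.ofReal p * coinSeqLaw p (Prod.mk u ⁻¹' displaySet move n b t) +
          ENNReal.ofReal (1 - p) * coinSeqLaw p (Prod.mk u ⁻¹' displaySet move n b f) := by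
        intro u
        rw [← coinLaw_true, ← coinLaw_false,
          ← coinSeqLaw_first_inter true (measurable_prodMk_left hmt),
          ← coinSeqLaw_first_inter false (measurable_prodMk_left hmf), ← measure_union]
        · rw [displaySet_succ_of_flip move h]; rfl
        · rw [Set.disjoint_left]
          rintro x ⟨hx, -⟩ ⟨hx', -⟩
          simp [hx] at hx'
        · exact .inter (measurableSet_eq_fun (measurable_pi_apply 0) measurable_const)
            (measurable_shift (measurable_prodMk_left hmf))
      rw [Measure.prod_apply hms]
      simp_rw [hsec]
      rw [lintegral_add_left ((measurable_measure_prodMk_left hmt).const_mul _),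
        lintegral_const_mul _ (measurable_measure_prodMk_left hmt),
        lintegral_const_mul _ (measurable_measure_prodMk_left hmf),
        ← Measure.prod_apply hmt, ← Measure.prod_apply hmf, ih ht, ih hf,
        ← ENNReal.ofReal_mul h0, ← ENNReal.ofReal_mul (by linarith), ← ENNReal.ofReal_add]
      · simp only [haltProb, h]
      · exact mul_nonneg h0 (haltProb_nonneg hI h0 h1 n b ht)
      · exact mul_nonneg (by linarith) (haltProb_nonneg hI h0 h1 n b hf)
    | aux a t f =>
      obtain ⟨⟨ha0, ha1⟩, ht, hf⟩ := hI.aux hs h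
      have hmt := measurableSet_displaySet move n b t
      have hmf := measurableSet_displaySet move n b f
      have hsec : ∀ x : ℕ → Bool,
          uniformLaw ((fun u => (u, x)) ⁻¹' displaySet move (n + 1) b s) =
          ENNReal.ofReal a * uniformLaw ((fun u => (u, x)) ⁻¹' displaySet move n b t) +
          ENNReal.ofReal (1 - a) * uniformLaw ((fun u => (u, x)) ⁻¹' displaySet move n b f) := by
        intro x
        rw [← uniformLaw_lt_inter ha0 ha1 (measurable_prodMk_right hmt),
          ← uniformLaw_ge_inter ha0 ha1 (measurable_prodMk_right hmf), ← measure_union]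
        · rw [displaySet_succ_of_aux move h]; rfl
        · rw [Set.disjoint_left]
          rintro u ⟨hu, -⟩ ⟨hu', -⟩
          exact hu' hu
        · exact .inter measurableSet_Iio.compl
            (((measurable_id.sub_const a).div_const (1 - a)) (measurable_prodMk_right hmf))
      rw [Measure.prod_apply_symm hms]
      simp_rw [hsec]
      rw [lintegral_add_left ((measurable_measure_prodMk_right hmt).const_mul _),
        lintegral_const_mul _ (measurable_measure_prodMk_right hmt),
        lintegral_const_mul _ (measurable_measure_prodMk_right hmf),
        ← Measure.prod_apply_symm hmt, ← Measure.prod_apply_symm hmf, ih ht, ih hf,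
        ← ENNReal.ofReal_mul ha0.le, ← ENNReal.ofReal_mul (by linarith), ← ENNReal.ofReal_add]
      · simp only [haltProb, h]
      · exact mul_nonneg ha0.le (haltProb_nonneg hI h0 h1 n b ht)
      · exact mul_nonneg (by linarith) (haltProb_nonneg hI h0 h1 n b hf)

theorem measurableSet_runAlgorithm (s : σ) (b : Bool) {Ω : Type u} [MeasurableSpace Ω]
    {U : Ω → unitInterval} {X : ℕ → Ω → Bool} (hU : Measurable U) (hX : ∀ n, Measurable (X n)) :
    MeasurableSet {ω | runAlgorithm move s (U ω) (fun n => X n ω) = some b} := by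
  have hm : Measurable fun ω => ((U ω : ℝ), fun n => X n ω) :=
    (measurable_subtype_coe.comp hU).prodMk (measurable_pi_lambda _ hX)
  simp only [runAlgorithm_eq_some_iff, Set.ofPred_exists]
  exact .iUnion fun n => hm (measurableSet_displaySet move n b s)

/-- The law of the output is the limit of the probabilities of the outputs at finite levels. -/
theorem IsCoinSource.measure_runAlgorithm {Ω : Type u} [MeasurableSpace Ω] {P : Measure Ω}
    [IsProbabilityMeasure P] {I : Set σ} (hI : IsInvariant move I) (h0 : 0 ≤ p) (h1 : p ≤ 1)
    {U : Ω → unitInterval} {X : ℕ → Ω → Bool} (h : IsCoinSource P p U X)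
    {s : σ} (hs : s ∈ I) {b : Bool} {q : ℝ}
    (hq : Filter.Tendsto (fun n => haltProb move p n b s) Filter.atTop (nhds q)) :
    P {ω | runAlgorithm move s (U ω) (fun n => X n ω) = some b} = ENNReal.ofReal q := by
  have := isProbabilityMeasure_coinLaw h0 h1
  have hm : Measurable fun ω => ((U ω : ℝ), fun n => X n ω) :=
    (measurable_subtype_coe.comp h.measurable_uniform).prodMk
      (measurable_pi_lambda _ h.measurable_coin)
  have hn : ∀ n, P ((fun ω => ((U ω : ℝ), fun n => X n ω)) ⁻¹' displaySet move n b s) =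
      ENNReal.ofReal (haltProb move p n b s) := fun n => by
    rw [← Measure.map_apply hm (measurableSet_displaySet move n b s), h.map_eq h0,
      measure_displaySet hI h0 h1 n b hs]
  have hset : {ω | runAlgorithm move s (U ω) (fun n => X n ω) = some b} =
      ⋃ n, (fun ω => ((U ω : ℝ), fun n => X n ω)) ⁻¹' displaySet move n b s := by
    ext ω
    simp only [Set.mem_ofPred_eq, runAlgorithm_eq_some_iff, Set.mem_iUnion]
    rfl
  have hmono : Monotone fun n =>
      (fun ω => ((U ω : ℝ), fun n => X n ω)) ⁻¹' displaySet move n b s :=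
    fun n m hnm ω hω => displayAt_mono move hnm hω
  rw [hset]
  refine tendsto_nhds_unique (tendsto_measure_iUnion_atTop hmono) ?_
  simp only [Function.comp_def, hn]
  exact ENNReal.tendsto_ofReal hq

end HaltProb

/-! ### Survival probabilities of a run and their limit -/

section HaltProb

variable {σ : Type} {move : σ → Move σ} {p : ℝ}

theorem haltProb_halt {s : σ} {c : Bool} (h : move s = .halt c) (n : ℕ) (b : Bool) :
    haltProb move p n b s = if c = b then 1 else 0 := by
  cases n <;> simp only [haltProb, h]

theorem haltProb_zero_flip {s t f : σ} (h : move s = .flip t f) (b : Bool) :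
    haltProb move p 0 b s = 0 := by
  simp only [haltProb, h]

theorem haltProb_zero_aux {s t f : σ} {a : ℝ} (h : move s = .aux a t f) (b : Bool) :
    haltProb move p 0 b s = 0 := by
  simp only [haltProb, h]

theorem haltProb_succ_flip {s t f : σ} (h : move s = .flip t f) (n : ℕ) (b : Bool) :
    haltProb move p (n + 1) b s =
      p * haltProb move p n b t + (1 - p) * haltProb move p n b f := by
  simp only [haltProb, h]

theorem haltProb_succ_aux {s t f : σ} {a : ℝ} (h : move s = .aux a t f) (n : ℕ) (b : Bool) :
    haltProb move p (n + 1) b s =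
      a * haltProb move p n b t + (1 - a) * haltProb move p n b f := by
  simp only [haltProb, h]

/-- A nonnegative function that is superharmonic for the run and dominates the output bounds the
probability of the output. -/
theorem haltProb_le {I : Set σ} (hI : IsInvariant move I) (h0 : 0 ≤ p) (h1 : p ≤ 1) {b : Bool}
    {W : σ → ℝ} (hW : ∀ s ∈ I, 0 ≤ W s)
    (halt : ∀ s ∈ I, ∀ c, move s = .halt c → (if c = b then 1 else 0) ≤ W s)
    (flip : ∀ s ∈ I, ∀ t f, move s = .flip t f → p * W t + (1 - p) * W f ≤ W s)
    (aux : ∀ s ∈ I, ∀ a t f, move s = .aux a t f → a * W t + (1 - a) * W f ≤ W s)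
    (n : ℕ) {s : σ} (hs : s ∈ I) : haltProb move p n b s ≤ W s := by
  induction n generalizing s with
  | zero =>
    cases h : move s with
    | halt c => rw [haltProb_halt h]; exact halt s hs c h
    | flip t f => rw [haltProb_zero_flip h]; exact hW s hs
    | aux a t f => rw [haltProb_zero_aux h]; exact hW s hs
  | succ n ih =>
    cases h : move s with
    | halt c => rw [haltProb_halt h]; exact halt s hs c h
    | flip t f =>
      obtain ⟨ht, hf⟩ := hI.flip hs h
      rw [haltProb_succ_flip h]
      exact (add_le_add (mul_le_mul_of_nonneg_left (ih ht) h0)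
        (mul_le_mul_of_nonneg_left (ih hf) (by linarith))).trans (flip s hs t f h)
    | aux a t f =>
      obtain ⟨⟨ha0, ha1⟩, ht, hf⟩ := hI.aux hs h
      rw [haltProb_succ_aux h]
      exact (add_le_add (mul_le_mul_of_nonneg_left (ih ht) ha0.le)
        (mul_le_mul_of_nonneg_left (ih hf) (by linarith))).trans (aux s hs a t f h)

variable (move p) in
/-- The probability that a run with mean `p` which starts with problem `s` has not halted at level
`n`. -/
noncomputable def runProb (n : ℕ) (s : σ) : ℝ :=
  1 - haltProb move p n true s - haltProb move p n false s

theorem runProb_halt {s : σ} {c : Bool} (h : move s = .halt c) (n : ℕ) :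
    runProb move p n s = 0 := by
  cases c <;> simp [runProb, haltProb_halt h]

theorem runProb_succ_flip {s t f : σ} (h : move s = .flip t f) (n : ℕ) :
    runProb move p (n + 1) s = p * runProb move p n t + (1 - p) * runProb move p n f := by
  simp only [runProb, haltProb_succ_flip h]
  ring

theorem runProb_succ_aux {s t f : σ} {a : ℝ} (h : move s = .aux a t f) (n : ℕ) :
    runProb move p (n + 1) s = a * runProb move p n t + (1 - a) * runProb move p n f := by
  simp only [runProb, haltProb_succ_aux h]
  ring

theorem runProb_zero_mem_Icc (s : σ) : runProb move p 0 s ∈ Set.Icc (0 : ℝ) 1 := by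
  cases h : move s with
  | halt c => simp [runProb_halt h]
  | flip t f => simp [runProb, haltProb_zero_flip h]
  | aux a t f => simp [runProb, haltProb_zero_aux h]

theorem runProb_mem_Icc {I : Set σ} (hI : IsInvariant move I) (h0 : 0 ≤ p) (h1 : p ≤ 1)
    (n : ℕ) {s : σ} (hs : s ∈ I) : runProb move p n s ∈ Set.Icc (0 : ℝ) 1 := by
  induction n generalizing s with
  | zero => exact runProb_zero_mem_Icc s
  | succ n ih =>
    cases h : move s with
    | halt c => simp [runProb_halt h]
    | flip t f =>
      obtain ⟨ht, hf⟩ := hI.flip hs h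
      rw [runProb_succ_flip h]
      exact convex_Icc 0 1 (ih ht) (ih hf) h0 (by linarith) (by ring)
    | aux a t f =>
      obtain ⟨⟨ha0, ha1⟩, ht, hf⟩ := hI.aux hs h
      rw [runProb_succ_aux h]
      exact convex_Icc 0 1 (ih ht) (ih hf) ha0.le (by linarith) (by ring)

theorem runProb_succ_le {I : Set σ} (hI : IsInvariant move I) (h0 : 0 ≤ p) (h1 : p ≤ 1)
    (n : ℕ) {s : σ} (hs : s ∈ I) : runProb move p (n + 1) s ≤ runProb move p n s := by
  induction n generalizing s with
  | zero =>
    have h01 := (runProb_mem_Icc hI h0 h1 1 hs).2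
    cases h : move s with
    | halt c => simp [runProb_halt h]
    | flip t f => simpa [runProb, haltProb_zero_flip h] using h01
    | aux a t f => simpa [runProb, haltProb_zero_aux h] using h01
  | succ n ih =>
    cases h : move s with
    | halt c => simp [runProb_halt h]
    | flip t f =>
      obtain ⟨ht, hf⟩ := hI.flip hs h
      rw [runProb_succ_flip h, runProb_succ_flip h]
      exact add_le_add (mul_le_mul_of_nonneg_left (ih ht) h0)
        (mul_le_mul_of_nonneg_left (ih hf) (by linarith))
    | aux a t f =>
      obtain ⟨⟨ha0, ha1⟩, ht, hf⟩ := hI.aux hs h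
      rw [runProb_succ_aux h, runProb_succ_aux h]
      exact add_le_add (mul_le_mul_of_nonneg_left (ih ht) ha0.le)
        (mul_le_mul_of_nonneg_left (ih hf) (by linarith))

variable (move p) in
/-- The probability that a run with mean `p` which starts with problem `s` never halts. -/
noncomputable def neverProb (s : σ) : ℝ :=
  ⨅ n, runProb move p n s

theorem tendsto_runProb {I : Set σ} (hI : IsInvariant move I) (h0 : 0 ≤ p) (h1 : p ≤ 1)
    {s : σ} (hs : s ∈ I) :
    Filter.Tendsto (fun n => runProb move p n s) Filter.atTop (nhds (neverProb move p s)) :=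
  tendsto_atTop_ciInf (antitone_nat_of_succ_le fun n => runProb_succ_le hI h0 h1 n hs)
    ⟨0, by rintro _ ⟨n, rfl⟩; exact (runProb_mem_Icc hI h0 h1 n hs).1⟩

theorem neverProb_mem_Icc {I : Set σ} (hI : IsInvariant move I) (h0 : 0 ≤ p) (h1 : p ≤ 1)
    {s : σ} (hs : s ∈ I) : neverProb move p s ∈ Set.Icc (0 : ℝ) 1 :=
  isClosed_Icc.mem_of_tendsto (tendsto_runProb hI h0 h1 hs)
    (Filter.Eventually.of_forall fun n => runProb_mem_Icc hI h0 h1 n hs)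

theorem neverProb_halt {s : σ} {c : Bool} (h : move s = .halt c) : neverProb move p s = 0 := by
  simp [neverProb, runProb_halt h]

/-- The recursion for `runProb` passes to the limit, so `neverProb` is harmonic for the moves;
`neverProb_aux` is the analogue for known coins. -/
theorem neverProb_flip {I : Set σ} (hI : IsInvariant move I) (h0 : 0 ≤ p) (h1 : p ≤ 1)
    {s t f : σ} (hs : s ∈ I) (h : move s = .flip t f) :
    neverProb move p s = p * neverProb move p t + (1 - p) * neverProb move p f := by
  obtain ⟨ht, hf⟩ := hI.flip hs h
  refine tendsto_nhds_unique
    ((tendsto_runProb hI h0 h1 hs).comp (Filter.tendsto_add_atTop_nat 1)) ?_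
  simp only [Function.comp_def, runProb_succ_flip h]
  exact ((tendsto_runProb hI h0 h1 ht).const_mul p).add
    ((tendsto_runProb hI h0 h1 hf).const_mul (1 - p))

theorem neverProb_aux {I : Set σ} (hI : IsInvariant move I) (h0 : 0 ≤ p) (h1 : p ≤ 1)
    {s t f : σ} {a : ℝ} (hs : s ∈ I) (h : move s = .aux a t f) :
    neverProb move p s = a * neverProb move p t + (1 - a) * neverProb move p f := by
  obtain ⟨-, ht, hf⟩ := hI.aux hs h
  refine tendsto_nhds_unique
    ((tendsto_runProb hI h0 h1 hs).comp (Filter.tendsto_add_atTop_nat 1)) ?_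
  simp only [Function.comp_def, runProb_succ_aux h]
  exact ((tendsto_runProb hI h0 h1 ht).const_mul a).add
    ((tendsto_runProb hI h0 h1 hf).const_mul (1 - a))

end HaltProb

/-- If every upper bound `M ≥ t` of a bounded function can be lowered towards `t` by a fixed
proportion, then `t` is an upper bound. -/
theorem le_of_upperBound_contraction {ι : Type*} {f : ι → ℝ} {B t δ : ℝ} (hB : ∀ x, f x ≤ B)
    (hδ : 0 < δ) (h : ∀ M, t ≤ M → (∀ x, f x ≤ M) → ∀ x, f x ≤ M - δ * (M - t)) (x : ι) :
    f x ≤ t := by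
  have hbdd : BddAbove (Set.range f) := ⟨B, by rintro _ ⟨y, rfl⟩; exact hB y⟩
  have : Nonempty ι := ⟨x⟩
  by_contra! hx
  have htM : t < ⨆ y, f y := hx.trans_le (le_ciSup hbdd x)
  -- Applied to the supremum itself, the hypothesis bounds it by something strictly smaller.
  have hle := ciSup_le (h (⨆ y, f y) htM.le (le_ciSup hbdd))
  nlinarith [mul_pos hδ (sub_pos.2 htM)]

/-! ### The recursive factory -/

/-- The problems with parameters in the range where the recursive factory is a Bernoulli factory,
for a coin with mean `p`. -/
def validProblems (p : ℝ) : Set Problem :=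
  {s | match s with
    | .power C ε _ => 1 < C ∧ 0 < ε ∧ ε < 1 ∧ C * p ≤ 1 - ε
    | .mixed C ε _ => 1 < C ∧ 0 < ε ∧ ε < 1 ∧ C * p ≤ 1 - ε
    | .zero => True}

theorem linearMove_power_zero (C ε : ℝ) : linearMove (.power C ε 0) = .halt true := by
  simp [linearMove]

theorem linearMove_power_reset {C ε : ℝ} {i : ℕ} (hi : i ≠ 0) (h : 4.6 / ε ≤ (i : ℝ)) :
    linearMove (.power C ε i) =
      .aux (1 / (1 + ε / 2) ^ i) (.power (C * (1 + ε / 2)) (ε / 2) i) .zero := by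
  simp [linearMove, hi, h]

theorem linearMove_power_flip {C ε : ℝ} {i : ℕ} (hi : i ≠ 0) (h : ¬ 4.6 / ε ≤ (i : ℝ)) :
    linearMove (.power C ε i) = .flip (.power C ε (i - 1)) (.mixed C ε (i - 1)) := by
  simp [linearMove, hi, h]

theorem linearMove_mixed (C ε : ℝ) (i : ℕ) :
    linearMove (.mixed C ε i) =
      .aux ((C - 1) / C) (.power C ε (i + 1)) (.mixed C ε (i + 1)) :=
  rfl

theorem linearMove_zero : linearMove .zero = .halt false :=
  rfl

/-- With the move as a second argument of the motive, properties are checked on five explicit pairs,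
without nested conditionals. In the case `flip` the exponent is written `i + 1`, which avoids
truncated subtraction. -/
theorem linearMove_induction {motive : Problem → Move Problem → Prop}
    (one : ∀ C ε, motive (.power C ε 0) (.halt true))
    (zero : motive .zero (.halt false))
    (flip : ∀ C ε i, ¬ 4.6 / ε ≤ ((i + 1 : ℕ) : ℝ) →
      motive (.power C ε (i + 1)) (.flip (.power C ε i) (.mixed C ε i)))
    (reset : ∀ (C ε : ℝ) (i : ℕ), i ≠ 0 → 4.6 / ε ≤ (i : ℝ) → motive (.power C ε i)
      (.aux (1 / (1 + ε / 2) ^ i) (.power (C * (1 + ε / 2)) (ε / 2) i) .zero))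
    (mixed : ∀ C ε i, motive (.mixed C ε i)
      (.aux ((C - 1) / C) (.power C ε (i + 1)) (.mixed C ε (i + 1)))) (s : Problem) :
    motive s (linearMove s) := by
  cases s with
  | zero => exact zero
  | mixed C ε i => exact mixed C ε i
  | power C ε i =>
    cases i with
    | zero => rw [linearMove_power_zero]; exact one C ε
    | succ i =>
      by_cases h : 4.6 / ε ≤ ((i + 1 : ℕ) : ℝ)
      · rw [linearMove_power_reset (Nat.succ_ne_zero i) h]
        exact reset C ε (i + 1) (Nat.succ_ne_zero i) h
      · rw [linearMove_power_flip (Nat.succ_ne_zero i) h]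
        exact flip C ε i h

/-- The new tolerance is admissible since `(1 - ε) * (1 + ε / 2) = 1 - ε / 2 - ε ^ 2 / 2 ≤ 1 - ε /
2`. -/
theorem reset_mem_validProblems {p C ε : ℝ} {i j : ℕ}
    (h : Problem.power C ε i ∈ validProblems p) :
    Problem.power (C * (1 + ε / 2)) (ε / 2) j ∈ validProblems p := by
  obtain ⟨hC, hε, hε1, hCp⟩ := h
  refine ⟨?_, by linarith, by linarith, ?_⟩
  · nlinarith
  · have : C * (1 + ε / 2) * p ≤ (1 - ε) * (1 + ε / 2) := by
      rw [mul_right_comm]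
      exact mul_le_mul_of_nonneg_right hCp (by linarith)
    nlinarith

theorem isInvariant_validProblems (p : ℝ) :
    IsInvariant linearMove (validProblems p) := by
  have key : ∀ s, s ∈ validProblems p →
      (∀ t f, linearMove s = .flip t f → t ∈ validProblems p ∧ f ∈ validProblems p) ∧
      ∀ a t f, linearMove s = .aux a t f →
        (0 < a ∧ a < 1) ∧ t ∈ validProblems p ∧ f ∈ validProblems p := by
    intro s
    refine linearMove_induction (motive := fun s m => s ∈ validProblems p →
      (∀ t f, m = .flip t f → t ∈ validProblems p ∧ f ∈ validProblems p) ∧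
      ∀ a t f, m = .aux a t f →
        (0 < a ∧ a < 1) ∧ t ∈ validProblems p ∧ f ∈ validProblems p) ?_ ?_ ?_ ?_ ?_ s
    · intro C ε _; simp
    · intro _; simp
    · intro C ε i _ hs
      refine ⟨?_, by simp⟩
      rintro t f ⟨⟩
      exact ⟨hs, hs⟩
    · intro C ε i hi _ hs
      refine ⟨by simp, ?_⟩
      rintro a t f ⟨⟩
      have hε := hs.2.1
      have hpow : 1 < (1 + ε / 2) ^ i := one_lt_pow₀ (by linarith) hi
      exact ⟨⟨by positivity, (div_lt_one (by linarith)).2 hpow⟩,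
        reset_mem_validProblems hs, trivial⟩
    · intro C ε i hs
      refine ⟨by simp, ?_⟩
      rintro a t f ⟨⟩
      have hC := hs.1
      exact ⟨⟨div_pos (by linarith) (by linarith), (div_lt_one (by linarith)).2 (by linarith)⟩,
        hs, hs⟩
  exact ⟨fun hs h => (key _ hs).1 _ _ h, fun hs h => (key _ hs).2 _ _ _ h⟩

/-! ### Conservation of the mean -/

/-- The mean that a problem asks for. -/
noncomputable def Problem.mean (p : ℝ) : Problem → ℝ
  | .power C _ i => (C * p) ^ i
  | .mixed C _ i => (C * p) ^ i * ((C - 1) * p / (1 - p))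
  | .zero => 0

theorem lt_one_of_mul_le {p C ε : ℝ} (h0 : 0 ≤ p) (hC : 1 < C) (hε : 0 < ε)
    (hCp : C * p ≤ 1 - ε) : p < 1 := by
  nlinarith

theorem mean_mem_Icc {p : ℝ} (h0 : 0 ≤ p) {s : Problem} (hs : s ∈ validProblems p) :
    s.mean p ∈ Set.Icc (0 : ℝ) 1 := by
  cases s with
  | zero => simp [Problem.mean]
  | power C ε i =>
    obtain ⟨hC, hε, hε1, hCp⟩ := hs
    have hCp0 : 0 ≤ C * p := by positivity
    exact ⟨pow_nonneg hCp0 i, pow_le_one₀ hCp0 (by linarith)⟩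
  | mixed C ε i =>
    obtain ⟨hC, hε, hε1, hCp⟩ := hs
    have hCp0 : 0 ≤ C * p := by positivity
    have hp := lt_one_of_mul_le h0 hC hε hCp
    have h1 : 0 ≤ (C - 1) * p / (1 - p) :=
      div_nonneg (mul_nonneg (by linarith) h0) (by linarith)
    -- Equivalent to `C * p ≤ 1`.
    have h2 : (C - 1) * p / (1 - p) ≤ 1 := (div_le_one (by linarith)).2 (by linarith)
    exact ⟨mul_nonneg (pow_nonneg hCp0 i) h1,
      mul_le_one₀ (pow_le_one₀ hCp0 (by linarith)) h1 h2⟩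

/-- Every move preserves the mean. -/
theorem mean_linearMove {p : ℝ} (h0 : 0 ≤ p) {s : Problem} (hs : s ∈ validProblems p) :
    match linearMove s with
    | .halt c => s.mean p = if c = true then 1 else 0
    | .flip t f => p * t.mean p + (1 - p) * f.mean p = s.mean p
    | .aux a t f => a * t.mean p + (1 - a) * f.mean p = s.mean p := by
  revert hs
  refine linearMove_induction (motive := fun s m => s ∈ validProblems p → match m with
    | .halt c => s.mean p = if c = true then 1 else 0
    | .flip t f => p * t.mean p + (1 - p) * f.mean p = s.mean p
    | .aux a t f => a * t.mean p + (1 - a) * f.mean p = s.mean p) ?_ ?_ ?_ ?_ ?_ s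
  · intro C ε _; simp [Problem.mean]
  · intro _; simp [Problem.mean]
  -- The factor `1 - p` cancels, and `p + (C - 1) * p = C * p` raises the exponent by one.
  · rintro C ε i - ⟨hC, hε, hε1, hCp⟩
    have hp : 1 - p ≠ 0 := by linarith [lt_one_of_mul_le h0 hC hε hCp]
    simp only [Problem.mean]
    field_simp
    ring
  · rintro C ε i - - ⟨hC, hε, hε1, hCp⟩
    have hpow : (1 + ε / 2) ^ i ≠ 0 := by positivity
    simp only [Problem.mean, mul_zero, add_zero]
    rw [mul_right_comm, mul_pow (C * p)]
    field_simp
  -- With `r = (C - 1) * p / (1 - p)`, heads contribute `(C - 1) * p = r * (1 - p)` and tails `p *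
  -- r`, up to the common factor `(C * p) ^ i`; the sum is `r`.
  · rintro C ε i ⟨hC, hε, hε1, hCp⟩
    have hp : 1 - p ≠ 0 := by linarith [lt_one_of_mul_le h0 hC hε hCp]
    have hC0 : C ≠ 0 := by linarith
    simp only [Problem.mean]
    field_simp
    ring

theorem haltProb_true_le_mean {p : ℝ} (h0 : 0 ≤ p) (h1 : p ≤ 1) (n : ℕ) {s : Problem}
    (hs : s ∈ validProblems p) : haltProb linearMove p n true s ≤ s.mean p := by
  refine haltProb_le (isInvariant_validProblems p) h0 h1 (fun s hs => (mean_mem_Icc h0 hs).1)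
    ?_ ?_ ?_ n hs
  · intro s hs c h
    have := mean_linearMove h0 hs
    rw [h] at this
    exact this.ge
  · intro s hs t f h
    have := mean_linearMove h0 hs
    rw [h] at this
    exact this.le
  · intro s hs a t f h
    have := mean_linearMove h0 hs
    rw [h] at this
    exact this.le

theorem haltProb_false_le_mean {p : ℝ} (h0 : 0 ≤ p) (h1 : p ≤ 1) (n : ℕ) {s : Problem}
    (hs : s ∈ validProblems p) : haltProb linearMove p n false s ≤ 1 - s.mean p := by
  refine haltProb_le (W := fun s => 1 - s.mean p) (isInvariant_validProblems p) h0 h1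
    (fun s hs => by linarith [(mean_mem_Icc h0 hs).2]) ?_ ?_ ?_ n hs
  · intro s hs c h
    have := mean_linearMove h0 hs
    rw [h] at this
    simp only at this
    cases c <;> simp_all
  · intro s hs t f h
    have := mean_linearMove h0 hs
    rw [h] at this
    simp only at this
    linarith
  · intro s hs a t f h
    have := mean_linearMove h0 hs
    rw [h] at this
    simp only at this
    linarith

/-! ### Almost sure halting of the recursive factory -/

theorem neverProb_reset_le {p Q C ε : ℝ} (h0 : 0 ≤ p) (h1 : p ≤ 1)
    (hQ : ∀ s ∈ validProblems p, neverProb linearMove p s ≤ Q) {i : ℕ}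
    (hs : Problem.power C ε i ∈ validProblems p) (hi : 4.6 / ε ≤ (i : ℝ)) :
    neverProb linearMove p (.power C ε i) ≤ Q / 2 := by
  have hI := isInvariant_validProblems p
  have hε := hs.2.1
  have hi0 : i ≠ 0 := by
    rintro rfl
    have : (0 : ℝ) < 4.6 / ε := by positivity
    simp only [Nat.cast_zero] at hi
    linarith
  have hnext := reset_mem_validProblems (j := i) hs
  -- Bernoulli's inequality gives at least `1 + i * ε / 2 ≥ 3.3`; for the factor 1/2 a threshold `2
  -- / ε` would already be enough.
  have hpow : 2 ≤ (1 + ε / 2) ^ i := by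
    have hb := one_add_mul_le_pow (a := ε / 2) (by linarith) i
    rw [div_le_iff₀ hε] at hi
    linarith
  have hα : 1 / (1 + ε / 2) ^ i ≤ 1 / 2 := one_div_le_one_div_of_le (by norm_num) hpow
  rw [neverProb_aux hI h0 h1 hs (linearMove_power_reset hi0 hi), neverProb_halt linearMove_zero]
  nlinarith [hQ _ hnext, (neverProb_mem_Icc hI h0 h1 hnext).1]

/-- Each flip in a problem `mixed` raises the exponent. After `d` tails and one heads the problem is
`power` with exponent `i + 1 + d ≥ K`, where the better bound `t` holds; on all other paths `M` is
used. -/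
theorem neverProb_mixed_le {p C ε M t : ℝ} (h0 : 0 ≤ p) (h1 : p ≤ 1) (hC : 1 < C) (hε : 0 < ε)
    (hε1 : ε < 1) (hCp : C * p ≤ 1 - ε) {K : ℕ}
    (hK : ∀ i, K ≤ i → neverProb linearMove p (.power C ε i) ≤ t)
    (hpower : ∀ i, neverProb linearMove p (.power C ε i) ≤ M)
    (hmixed : ∀ i, neverProb linearMove p (.mixed C ε i) ≤ M) (d i : ℕ) (hd : K ≤ i + 1 + d) :
    neverProb linearMove p (.mixed C ε i) ≤
      M - (C - 1) / C * (1 - (C - 1) / C) ^ d * (M - t) := by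
  have hs : ∀ i, Problem.mixed C ε i ∈ validProblems p := fun i => ⟨hC, hε, hε1, hCp⟩
  have hI := isInvariant_validProblems p
  obtain ⟨⟨ha0, ha1⟩, -⟩ := hI.aux (hs i) (linearMove_mixed C ε i)
  induction d generalizing i with
  | zero =>
    rw [neverProb_aux hI h0 h1 (hs i) (linearMove_mixed C ε i)]
    have h2 := mul_le_mul_of_nonneg_left (hK (i + 1) hd) ha0.le
    have h3 := mul_le_mul_of_nonneg_left (hmixed (i + 1)) (sub_nonneg.2 ha1.le)
    rw [pow_zero]
    linarith
  | succ d ih =>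
    rw [neverProb_aux hI h0 h1 (hs i) (linearMove_mixed C ε i)]
    have h2 := mul_le_mul_of_nonneg_left (hpower (i + 1)) ha0.le
    have h3 := mul_le_mul_of_nonneg_left (ih (i + 1) (by omega)) (sub_nonneg.2 ha1.le)
    rw [pow_succ']
    linarith

/-- For fixed `C` and `ε`, a common bound `M` for all exponents contracts towards `Q / 2`. A problem
`mixed` gains by `neverProb_mixed_le`, and a problem `power` below the threshold gains after tails,
which has probability `1 - p > 0`. -/
theorem neverProb_le_half {p Q : ℝ} (h0 : 0 ≤ p) (h1 : p ≤ 1)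
    (hQ : ∀ s ∈ validProblems p, neverProb linearMove p s ≤ Q) {C ε : ℝ} (hC : 1 < C) (hε : 0 < ε)
    (hε1 : ε < 1) (hCp : C * p ≤ 1 - ε) (i : ℕ) :
    max (neverProb linearMove p (.power C ε i)) (neverProb linearMove p (.mixed C ε i)) ≤
      Q / 2 := by
  have hI := isInvariant_validProblems p
  have hsp : ∀ i, Problem.power C ε i ∈ validProblems p := fun i => ⟨hC, hε, hε1, hCp⟩
  have hsm : ∀ i, Problem.mixed C ε i ∈ validProblems p := fun i => ⟨hC, hε, hε1, hCp⟩
  obtain ⟨⟨ha0, ha1⟩, -⟩ := hI.aux (hsm 0) (linearMove_mixed C ε 0)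
  have hp := lt_one_of_mul_le h0 hC hε hCp
  have hQ0 : 0 ≤ Q := (neverProb_mem_Icc hI h0 h1 (hsp 0)).1.trans (hQ _ (hsp 0))
  obtain ⟨K, hK⟩ := exists_nat_ge (4.6 / ε)
  have hreset : ∀ i : ℕ, 4.6 / ε ≤ (i : ℝ) → neverProb linearMove p (.power C ε i) ≤ Q / 2 :=
    fun i hi => neverProb_reset_le h0 h1 hQ (hsp i) hi
  -- The probability of `K` tails followed by heads. Taking `K` tails whatever the initial exponent
  -- makes the gain uniform in `i`.
  set δ := (C - 1) / C * (1 - (C - 1) / C) ^ K with hδ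
  have hδ0 : 0 < δ := mul_pos ha0 (pow_pos (by linarith) K)
  have hδ1 : δ ≤ 1 := mul_le_one₀ ha1.le (pow_nonneg (by linarith) K)
    (pow_le_one₀ (by linarith) (by linarith))
  refine le_of_upperBound_contraction
    (f := fun i =>
      max (neverProb linearMove p (.power C ε i)) (neverProb linearMove p (.mixed C ε i)))
    (B := Q) (δ := (1 - p) * δ) (fun i => max_le (hQ _ (hsp i)) (hQ _ (hsm i)))
    (mul_pos (by linarith) hδ0) (fun M hM hle => ?_) i
  have hmixed : ∀ i, neverProb linearMove p (.mixed C ε i) ≤ M - δ * (M - Q / 2) := fun i =>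
    neverProb_mixed_le h0 h1 hC hε hε1 hCp
      (fun j hj => hreset j (hK.trans (by exact_mod_cast hj)))
      (fun j => (le_max_left _ _).trans (hle j)) (fun j => (le_max_right _ _).trans (hle j)) K i
      (by omega)
  have hgap : 0 ≤ δ * (M - Q / 2) := mul_nonneg hδ0.le (by linarith)
  have hle1 : (1 - p) * δ * (M - Q / 2) ≤ δ * (M - Q / 2) := by nlinarith
  have hle2 : δ * (M - Q / 2) ≤ M - Q / 2 := by nlinarith
  intro i
  refine max_le ?_ ((hmixed i).trans (by linarith))
  by_cases hi : i = 0
  · rw [hi, neverProb_halt (linearMove_power_zero C ε)]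
    linarith
  by_cases h : 4.6 / ε ≤ (i : ℝ)
  · exact (hreset i h).trans (by linarith)
  · rw [neverProb_flip hI h0 h1 (hsp i) (linearMove_power_flip hi h)]
    have h2 := mul_le_mul_of_nonneg_left ((le_max_left _ _).trans (hle (i - 1))) h0
    have h3 := mul_le_mul_of_nonneg_left (hmixed (i - 1)) (sub_nonneg.2 h1)
    linarith

/-- By `neverProb_le_half` any bound valid for all parameters may be halved, so the contraction
towards 0 has proportion 1/2. -/
theorem neverProb_linearMove {p : ℝ} (h0 : 0 ≤ p) (h1 : p ≤ 1) {s : Problem}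
    (hs : s ∈ validProblems p) : neverProb linearMove p s = 0 := by
  have hI := isInvariant_validProblems p
  refine le_antisymm ?_ (neverProb_mem_Icc hI h0 h1 hs).1
  refine le_of_upperBound_contraction (f := fun s : validProblems p => neverProb linearMove p s)
    (B := 1) (δ := 1 / 2) (fun s => (neverProb_mem_Icc hI h0 h1 s.2).2) (by norm_num)
    (fun M hM hle => ?_) ⟨s, hs⟩
  have hQ : ∀ s ∈ validProblems p, neverProb linearMove p s ≤ M := fun s hs => hle ⟨s, hs⟩
  rintro ⟨s, hs⟩
  cases s with
  | zero =>
    simp only [neverProb_halt linearMove_zero]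
    linarith
  | power C ε i =>
    obtain ⟨hC, hε, hε1, hCp⟩ := hs
    have h := (le_max_left _ _).trans (neverProb_le_half h0 h1 hQ hC hε hε1 hCp i)
    simp only
    linarith
  | mixed C ε i =>
    obtain ⟨hC, hε, hε1, hCp⟩ := hs
    have h := (le_max_right _ _).trans (neverProb_le_half h0 h1 hQ hC hε hε1 hCp i)
    simp only
    linarith

/-- A squeeze: the bound on the output `false` yields the lower bound `s.mean p - runProb`, and
`runProb` tends to 0. -/
theorem tendsto_haltProb_true {p : ℝ} (h0 : 0 ≤ p) (h1 : p ≤ 1) {s : Problem}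
    (hs : s ∈ validProblems p) :
    Filter.Tendsto (fun n => haltProb linearMove p n true s) Filter.atTop (nhds (s.mean p)) := by
  have hrun := tendsto_runProb (isInvariant_validProblems p) h0 h1 hs
  rw [neverProb_linearMove h0 h1 hs] at hrun
  have hlow : Filter.Tendsto (fun n => s.mean p - runProb linearMove p n s) Filter.atTop
      (nhds (s.mean p)) := by
    simpa using hrun.const_sub (s.mean p)
  refine tendsto_of_tendsto_of_tendsto_of_le_of_le hlow tendsto_const_nhds (fun n => ?_)
    fun n => haltProb_true_le_mean h0 h1 n hs
  have := haltProb_false_le_mean h0 h1 n hs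
  simp only [runProb]
  linarith

theorem tendsto_haltProb_false {p : ℝ} (h0 : 0 ≤ p) (h1 : p ≤ 1) {s : Problem}
    (hs : s ∈ validProblems p) :
    Filter.Tendsto (fun n => haltProb linearMove p n false s) Filter.atTop
      (nhds (1 - s.mean p)) := by
  have hrun := tendsto_runProb (isInvariant_validProblems p) h0 h1 hs
  rw [neverProb_linearMove h0 h1 hs] at hrun
  have h := ((tendsto_haltProb_true h0 h1 hs).const_sub 1).sub hrun
  rw [sub_zero] at h
  refine h.congr fun n => ?_
  simp only [runProb]
  ring

end CoinFactory

/-! ### The Bernoulli factory -/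

theorem mainTheorem2 (C ε : ℝ) (hC : 1 < C) (hε : 0 < ε) (hε1 : ε < 1) (i : ℕ) :
    CoinFactory.IsBernoulliFactory.{u} ((1 - ε) / C) (fun p : ℝ => (C * p) ^ i)
      (CoinFactory.linearFactory C ε i) := by
  have hmax : (1 - ε) / C ≤ 1 := (div_le_one (by linarith)).2 (by linarith)
  have hvalid : ∀ p ∈ Set.Icc 0 ((1 - ε) / C),
      CoinFactory.Problem.power C ε i ∈ CoinFactory.validProblems p := fun p hp =>
    ⟨hC, hε, hε1, by rw [mul_comm]; exact (le_div_iff₀ (by linarith)).1 hp.2⟩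
  have hlaw : ∀ {Ω : Type u} [MeasurableSpace Ω] (P : Measure Ω) [IsProbabilityMeasure P],
      ∀ p ∈ Set.Icc 0 ((1 - ε) / C), ∀ (U : Ω → unitInterval) (X : ℕ → Ω → Bool),
      CoinFactory.IsCoinSource P p U X →
        (∀ b : Bool, MeasurableSet
          {ω | CoinFactory.linearFactory C ε i (U ω) (fun n => X n ω) = some b}) ∧
        P {ω | CoinFactory.linearFactory C ε i (U ω) (fun n => X n ω) = some true} =
          ENNReal.ofReal ((C * p) ^ i) ∧
        P {ω | CoinFactory.linearFactory C ε i (U ω) (fun n => X n ω) = some false} =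
          ENNReal.ofReal (1 - (C * p) ^ i) := by
    intro Ω _ P _ p hp U X h
    have h1 : p ≤ 1 := hp.2.trans hmax
    have hI := CoinFactory.isInvariant_validProblems p
    refine ⟨fun b => CoinFactory.measurableSet_runAlgorithm _ b h.measurable_uniform
      h.measurable_coin, ?_, ?_⟩
    · exact h.measure_runAlgorithm hI hp.1 h1 (hvalid p hp)
        (CoinFactory.tendsto_haltProb_true hp.1 h1 (hvalid p hp))
    · exact h.measure_runAlgorithm hI hp.1 h1 (hvalid p hp)
        (CoinFactory.tendsto_haltProb_false hp.1 h1 (hvalid p hp))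
  refine ⟨⟨div_pos (by linarith) (by linarith), hmax⟩,
    fun p hp => CoinFactory.mean_mem_Icc hp.1 (hvalid p hp),
    CoinFactory.isComputable_linearFactory, ?_, ?_, hlaw⟩
  · intro Ω _ P _ p hp U X h
    exact CoinFactory.isStoppingTime_runningTime _ h.measurable_uniform h.measurable_coin _
  · intro Ω _ P _ p hp U X h
    obtain ⟨hm, ht, hf⟩ := hlaw P p hp U X h
    have hmean : (C * p) ^ i ∈ Set.Icc (0 : ℝ) 1 := CoinFactory.mean_mem_Icc hp.1 (hvalid p hp)
    have hdisj : Disjoint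
        {ω | CoinFactory.linearFactory C ε i (U ω) (fun n => X n ω) = some true}
        {ω | CoinFactory.linearFactory C ε i (U ω) (fun n => X n ω) = some false} := by
      rw [Set.disjoint_left]
      intro ω h1 h2
      simp only [Set.mem_ofPred_eq] at h1 h2
      simp [h1] at h2
    -- The two output probabilities add up to 1, so almost surely a value is returned after finitely
    -- many levels, hence after finitely many coins.
    have hunion := measure_union (μ := P) hdisj (hm false)
    rw [ht, hf, ← ENNReal.ofReal_add hmean.1 (sub_nonneg.2 hmean.2), add_sub_cancel,
      ENNReal.ofReal_one] at hunion
    have hae := (mem_ae_iff_prob_eq_one ((hm true).union (hm false))).2 hunion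
    filter_upwards [hae] with ω hω
    rcases hω with hω | hω
    · exact CoinFactory.runningTime_lt_top_of_eq_some _ hω
    · exact CoinFactory.runningTime_lt_top_of_eq_some _ hω
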